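/- **Setting.** Let $D(\alpha)=\bigotimes_{i=1}^n e^{\alpha_i a_i^\dagger-\alpha_i^* a_i}$, $\alpha\in\mathbb{C}^n$, be the displacement operators of an $n$-mode bosonic system and $\chi_\rho(\alpha)=\mathrm{Tr}[\rho D(\alpha)]$ the characteristic function of a state $\rho$. For $s\in[-1,1]$ the $s$-ordered quasiprobability distribution $W_\rho(s)$ is the Fourier transform of $\chi_\rho(s,\alpha)=e^{s|\alpha|^2/2}\chi_\rho(\alpha)$; it is called nonnegative if it is a probability measure on $\mathbb{C}^n$ (possibly singular), i.e. $\int W_\rho(s,d\beta)\,e^{\beta^\dagger\alpha-\alpha^\dagger\beta}=\chi_\rho(s,\alpha)$ for all $\alpha$. The classicality $s_{\max}$ of $\rho$ is the largest $s\in[-1,1]$ for which $W_\rho(s)$ is nonnegative. For a symmetric unitary $U\in\mathbb{C}^{n\times n}$, a reflected state $\rho^{(U)}$ is a state with $\chi_{\rho^{(U)}}(\alpha)=\chi_\rho(U\alpha^*)$, and $\mathcal U$ denotes a (linear-optical) unitary operator with $\mathcal U^\dagger D(\alpha)\,\mathcal U=D(U^{T}\alpha)$. The Bell measurement on two $n$-mode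 registers has outcome $\zeta\in\mathbb{C}^n$ and POVM $$\Pi(\zeta)=\int\frac{d^{2n}\alpha}{\pi^{2n}}\,e^{\zeta\cdot\alpha-\zeta^*\cdot\alpha^*}\,D(\alpha)\otimes D(\alpha^*),$$ so that the outcome density on a state $\tau$ is $\pi^{-2n}\int d^{2n}\alpha\, e^{\zeta\cdot\alpha-\zeta^*\cdot\alpha^*}\,\mathrm{Tr}[\tau\,(D(\alpha)\otimes D(\alpha^*))]$. For a probability measure $p$ on $\mathbb{C}^n$, the random-displacement channel is $\Lambda_p(\rho)=\int p(d\alpha)\,D(\alpha)\rho D(\alpha)^\dagger$, and $|\Psi_r\rangle=(\cosh r)^{-n}\sum_{k\in\mathbb{N}^n}(\tanh r)^{k_1+\dots+k_n}|k\rangle|k\rangle$ is the vector of $n$ two-mode squeezed vacua with squeezing $r$. The Bell-measurement state-learning scheme measures $\rho\otimes\mathcal U\rho^{(U)}\mathcal U^\dagger$; the channel-learning scheme for $\Lambda_p$ measures $(\Lambda_p\otimes\mathcal I)(|\Psi_r\rangle\langle\Psi_r|)$ (channel output in the first port, idler in the second). **Theorem.** Let $\rho$ be an $n$-mode state with $s_{\max}>0$.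 Then $W_\rho(s_{\max})$ is a probability measure, and for every $$r\;\ge\; r_*(\rho)=\tfrac12\ln\frac1{s_{\max}}$$ one has $s_{\max}-e^{-2r}\ge 0$ and $$p \;=\; W_\rho(s_{\max})*W_\rho(s_{\max})*\mathcal N_{\,s_{\max}-e^{-2r}}$$ is a probability measure on $\mathbb{C}^n$, where $\mathcal N_c$ is the centred isotropic complex Gaussian with $\int\mathcal N_c(d\beta)\,e^{\beta^\dagger\alpha-\alpha^\dagger\beta}=e^{-c|\alpha|^2}$ (real and imaginary parts independent of variance $c/2$; $\mathcal N_0=\delta_0$). Moreover, for every symmetric unitary $U$, every reflected state $\rho^{(U)}$ and every $\mathcal U$ as above, the Bell-measurement outcome density of the state-learning scheme on $\rho\otimes\rho^{(U)}$ and that of the channel-learning scheme for $\Lambda_p$ with input $|\Psi_r\rangle\langle\Psi_r|$ exist as probability densities on $\mathbb{C}^n$ and coincide. -/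

import Mathlib

open MeasureTheory Real Complex
open scoped InnerProductSpace ENNReal NNReal TensorProduct BigOperators

noncomputable section

namespace BosonicLearning

/-! ### Phase space and the Hilbert space of `n` modes -/

/-- The complex phase space `ℂⁿ` (with Lebesgue measure `d²ⁿα = ∏ d(Re αᵢ) d(Im αᵢ)`). -/
abbrev Phase (n : ℕ) : Type := Fin n → ℂ

/-- `|α|² = ∑ᵢ |αᵢ|²`. -/
def normSqSum {n : ℕ} (α : Phase n) : ℝ := ∑ i, ‖α i‖ ^ 2

/-- `e^{β†α - α†β}`, a complex number of modulus one. -/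
def sympChar {n : ℕ} (β α : Phase n) : ℂ :=
  Complex.exp (star β ⬝ᵥ α - star α ⬝ᵥ β)

/-- The Hilbert space `L²(ℝⁿ)` of `n` bosonic modes, in the Schrödinger (position) representation,
in which `âⱼ = (xⱼ + ∂ⱼ)/√2`. -/
abbrev ModeSpace (n : ℕ) : Type := Lp ℂ 2 (volume : Measure (Fin n → ℝ))

/-- Bounded operators on a Hilbert space. -/
abbrev Op (K : Type*) [NormedAddCommGroup K] [InnerProductSpace ℂ K] : Type _ := K →L[ℂ] K

/-! ### Displacement operators -/

/-- The phase `exp(i ∑ⱼ (√2 Im αⱼ xⱼ - Re αⱼ Im αⱼ))`. -/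
def displacementPhase {n : ℕ} (α : Phase n) (x : Fin n → ℝ) : ℂ :=
  Complex.exp (((∑ j, (√2 * (α j).im * x j - (α j).re * (α j).im) : ℝ) : ℂ) * Complex.I)

theorem continuous_displacementPhase {n : ℕ} (α : Phase n) :
    Continuous (displacementPhase α) := by
  unfold displacementPhase
  fun_prop

theorem norm_displacementPhase {n : ℕ} (α : Phase n) (x : Fin n → ℝ) :
    ‖displacementPhase α x‖ = 1 :=
  Complex.norm_exp_ofReal_mul_I _

theorem memLp_displacementPhase {n : ℕ} (α : Phase n) :
    MemLp (displacementPhase α) ∞ (volume : Measure (Fin n → ℝ)) :=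
  memLp_top_of_bound (continuous_displacementPhase α).aestronglyMeasurable 1
    (Filter.Eventually.of_forall fun x => (norm_displacementPhase α x).le)

/-- Translation `f ↦ f(· - c)` on `L²(ℝⁿ)`. -/
def translation {n : ℕ} (c : Fin n → ℝ) : Op (ModeSpace n) :=
  (Lp.compMeasurePreservingₗᵢ ℂ (fun x : Fin n → ℝ => x - c)
    (measurePreserving_sub_right volume c)).toContinuousLinearMap

/-- The displacement operator `D(α) = ⨂ⱼ exp(αⱼ âⱼ† - αⱼ* âⱼ)`.  Since
`α â† - α* â = i√2 (Im α) x - √2 (Re α) ∂`, it acts on wave functions by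
`(D(α)f)(x) = exp(i ∑ⱼ (√2 Im αⱼ xⱼ - Re αⱼ Im αⱼ)) f(x - √2 Re α)`; see `displacement_ae`. -/
def displacement {n : ℕ} (α : Phase n) : Op (ModeSpace n) :=
  ((ContinuousLinearMap.mul ℂ ℂ).holderL volume ∞ 2 2 (memLp_displacementPhase α).toLp) ∘L
    translation (fun j => √2 * (α j).re)

theorem displacement_ae {n : ℕ} (α : Phase n) (f : ModeSpace n) :
    (displacement α f : (Fin n → ℝ) → ℂ) =ᵐ[volume]
      fun x => displacementPhase α x * f (x - fun j => √2 * (α j).re) := by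
  have h1 : (displacement α f : (Fin n → ℝ) → ℂ) =ᵐ[volume] _ :=
    (ContinuousLinearMap.mul ℂ ℂ).coeFn_holder (r := 2)
      (memLp_displacementPhase α).toLp (translation (fun j => √2 * (α j).re) f)
  have h2 : (translation (fun j => √2 * (α j).re) f : (Fin n → ℝ) → ℂ) =ᵐ[volume]
      (f : (Fin n → ℝ) → ℂ) ∘ fun x => x - fun j => √2 * (α j).re :=
    Lp.coeFn_compMeasurePreserving f (measurePreserving_sub_right volume _)
  filter_upwards [h1, h2, (memLp_displacementPhase α).coeFn_toLp] with x a b c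
  rw [a, b, c]
  rfl

/-! ### Number states -/

/-- The wave function of the number state `|k⟩` of one mode, the Hermite function
`(k! √π)^{-1/2} Heₖ(√2 x) e^{-x²/2}`, where `Heₖ(√2 x) = 2^{-k/2} Hₖ(x)`. -/
def hermiteFn (k : ℕ) (x : ℝ) : ℝ :=
  (√((k.factorial : ℝ) * √π))⁻¹ *
    ((Polynomial.aeval (√2 * x) (Polynomial.hermite k) : ℝ) * Real.exp (-(x ^ 2) / 2))

/-- The wave function of the `n`-mode number state `|k₁, …, kₙ⟩`. -/
def numberFn {n : ℕ} (k : Fin n → ℕ) (x : Fin n → ℝ) : ℂ := ∏ i, (hermiteFn (k i) (x i) : ℂ)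

theorem continuous_hermiteFn (k : ℕ) : Continuous (hermiteFn k) := by
  unfold hermiteFn
  have : Continuous fun x : ℝ => (Polynomial.aeval (√2 * x) (Polynomial.hermite k) : ℝ) :=
    (Polynomial.continuous_aeval _).comp (by fun_prop)
  fun_prop

theorem integrable_poly_mul_gaussian (q : Polynomial ℝ) :
    Integrable fun x : ℝ => q.eval x * Real.exp (-(x ^ 2)) := by
  induction q using Polynomial.induction_on' with
  | add p q hp hq =>
    refine (hp.add hq).congr (Filter.Eventually.of_forall fun x => ?_)
    simp [add_mul]
  | monomial m a =>
    have h := integrable_rpow_mul_exp_neg_mul_sq (b := 1) one_pos (s := (m : ℝ))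
      (by have : (0 : ℝ) ≤ m := m.cast_nonneg
          linarith)
    simpa [mul_assoc] using h.const_mul a

theorem integrable_hermiteFn_sq (k : ℕ) : Integrable fun x : ℝ => hermiteFn k x ^ 2 := by
  set P : Polynomial ℝ :=
    ((Polynomial.hermite k).map (Int.castRingHom ℝ)).comp (Polynomial.C √2 * Polynomial.X) with hP
  have h := (integrable_poly_mul_gaussian (P ^ 2)).const_mul
    ((√((k.factorial : ℝ) * √π))⁻¹ ^ 2)
  refine h.congr (Filter.Eventually.of_forall fun x => ?_)
  have e : Real.exp (-(x ^ 2)) = Real.exp (-(x ^ 2) / 2) ^ 2 := by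
    rw [← Real.exp_nat_mul]
    congr 1
    push_cast
    ring
  have ev : P.eval x = (Polynomial.aeval (√2 * x) (Polynomial.hermite k) : ℝ) := by
    simp [hP, Polynomial.aeval_def, Polynomial.eval_map]
  simp only [hermiteFn, Polynomial.eval_pow, ev, e]
  ring

theorem memLp_numberFn {n : ℕ} (k : Fin n → ℕ) :
    MemLp (numberFn k) 2 (volume : Measure (Fin n → ℝ)) := by
  have hc : Continuous (numberFn k) := by
    unfold numberFn
    exact continuous_finsetProd _ fun i _ =>
      Complex.continuous_ofReal.comp ((continuous_hermiteFn (k i)).comp (continuous_apply i))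
  rw [memLp_two_iff_integrable_sq_norm hc.aestronglyMeasurable]
  have h : Integrable (fun x : Fin n → ℝ => ∏ i, hermiteFn (k i) (x i) ^ 2) volume :=
    Integrable.fintype_prod (f := fun i y => hermiteFn (k i) y ^ 2)
      fun i => integrable_hermiteFn_sq (k i)
  refine h.congr (Filter.Eventually.of_forall fun x => ?_)
  simp [numberFn, Finset.prod_pow, ← Finset.abs_prod]

/-- The number state `|k₁, …, kₙ⟩`. -/
def numberState {n : ℕ} (k : Fin n → ℕ) : ModeSpace n := (memLp_numberFn k).toLp

/-! ### Two registers, trace, states -/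

/-- The Hilbert space of two `n`-mode registers: the Hilbert tensor product of two copies of
`ModeSpace n`. -/
abbrev PairSpace (n : ℕ) : Type :=
  UniformSpace.Completion (ModeSpace n ⊗[ℂ] ModeSpace n)

/-- The product vector `f ⊗ g`. -/
def vecTensor {n : ℕ} (f g : ModeSpace n) : PairSpace n :=
  ((f ⊗ₜ[ℂ] g : ModeSpace n ⊗[ℂ] ModeSpace n) : PairSpace n)

/-- The operator `A ⊗ B` on two registers. -/
def opTensor {n : ℕ} (A B : Op (ModeSpace n)) : Op (PairSpace n) :=
  (TensorProduct.mapL A B).completion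

theorem opTensor_vecTensor {n : ℕ} (A B : Op (ModeSpace n)) (f g : ModeSpace n) :
    opTensor A B (vecTensor f g) = vecTensor (A f) (B g) := by
  simp [opTensor, vecTensor]

section Trace

variable {K : Type*} [NormedAddCommGroup K] [InnerProductSpace ℂ K] [CompleteSpace K]

/-- The trace `Tr T = ∑ᵢ ⟨eᵢ, T eᵢ⟩` in an orthonormal basis.  For the trace-class operators `T` to
which it is applied the value does not depend on the basis. -/
def opTrace (T : Op K) : ℂ :=
  ∑' i, ⟪(exists_hilbertBasis ℂ K).choose_spec.choose i,
    T ((exists_hilbertBasis ℂ K).choose_spec.choose i)⟫_ℂ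

/-- Quantum states: positive operators of trace one (a nonzero trace forces the sum of the
nonnegative diagonal entries to converge, so such an operator is trace class). -/
structure IsState (ρ : Op K) : Prop where
  isPositive : ρ.IsPositive
  trace_eq_one : opTrace ρ = 1

/-- `V T V†`. -/
def conjOp (V T : Op K) : Op K := V ∘L T ∘L ContinuousLinearMap.adjoint V

end Trace

/-! ### Characteristic functions, ordered quasiprobability distributions, classicality -/

/-- The characteristic function `χ_ρ(α) = Tr[ρ D(α)]`. -/
def charFn {n : ℕ} (ρ : Op (ModeSpace n)) (α : Phase n) : ℂ := opTrace (ρ ∘L displacement α)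

/-- The `s`-ordered characteristic function `χ_ρ(s, α) = e^{s|α|²/2} χ_ρ(α)`. -/
def orderedCharFn {n : ℕ} (ρ : Op (ModeSpace n)) (s : ℝ) (α : Phase n) : ℂ :=
  (Real.exp (s * normSqSum α / 2) : ℂ) * charFn ρ α

/-- `W` is the `s`-ordered quasiprobability distribution `W_ρ(s, ·)`, the Fourier transform of
`χ_ρ(s, ·)`, and it is nonnegative and no more singular than a delta function, i.e. it is a
probability measure: `∫ W(dβ) e^{β†α - α†β} = χ_ρ(s, α)` for all `α`. -/
structure IsNonnegQPD {n : ℕ} (ρ : Op (ModeSpace n)) (s : ℝ) (W : Measure (Phase n)) : Prop where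
  isProbability : IsProbabilityMeasure W
  fourier : ∀ α : Phase n, ∫ β, sympChar β α ∂W = orderedCharFn ρ s α

/-- The classicality parameter `s_max`: the largest `s ∈ [-1, 1]` for which `W_ρ(s, ·) ≥ 0`. -/
def classicality {n : ℕ} (ρ : Op (ModeSpace n)) : ℝ :=
  sSup {s : ℝ | s ∈ Set.Icc (-1 : ℝ) 1 ∧ ∃ W : Measure (Phase n), IsNonnegQPD ρ s W}

/-! ### Reflected states and linear optics -/

/-- `σ` is the reflected state `ρ^(U)`: `χ_σ(α) = χ_ρ(U α*)`. -/
def IsReflectedState {n : ℕ} (U : Matrix (Fin n) (Fin n) ℂ) (ρ σ : Op (ModeSpace n)) : Prop :=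
  IsState σ ∧ ∀ α : Phase n, charFn σ α = charFn ρ (U.mulVec (star α))

/-- `V` is a unitary operator implementing the passive linear-optical circuit of `U`:
`V† D(α) V = D(Uᵀ α)`. -/
def IsPassiveUnitary {n : ℕ} (U : Matrix (Fin n) (Fin n) ℂ) (V : Op (ModeSpace n)) : Prop :=
  V ∈ unitary (Op (ModeSpace n)) ∧
    ∀ α : Phase n, ContinuousLinearMap.adjoint V ∘L displacement α ∘L V =
      displacement (U.transpose.mulVec α)

/-! ### Two-mode squeezed vacuum and random-displacement channels -/

/-- `n` two-mode squeezed vacua with squeezing parameter `r`: the vector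
`(cosh r)^{-n} ∑ₖ (tanh r)^{|k|} |k⟩ ⊗ |k⟩`, the sum being over `k ∈ ℕⁿ`. -/
def tmsv (n : ℕ) (r : ℝ) : PairSpace n :=
  ((Real.cosh r ^ n)⁻¹ : ℂ) •
    ∑' k : Fin n → ℕ, ((Real.tanh r ^ (∑ i, k i) : ℝ) : ℂ) •
      vecTensor (numberState k) (numberState k)

/-- The random-displacement channel `Λ_p(ρ) = ∫ p(dα) D(α) ρ D(α)†` with distribution `p`, acting on
the first of two registers while the second one is an idler:
`(Λ_p ⊗ id)(τ) = ∫ p(dα) (D(α) ⊗ 1) τ (D(α) ⊗ 1)†`. -/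
def randomDisplacementFst {n : ℕ} (p : Measure (Phase n)) (τ : Op (PairSpace n)) :
    Op (PairSpace n) :=
  ∫ α, conjOp (opTensor (displacement α) 1) τ ∂p

/-- The state `(Λ_p ⊗ id)(|Ψ_r⟩⟨Ψ_r|)` measured in the channel-learning scheme. -/
def channelLearningState {n : ℕ} (p : Measure (Phase n)) (r : ℝ) : Op (PairSpace n) :=
  randomDisplacementFst p (InnerProductSpace.rankOne ℂ (tmsv n r) (tmsv n r))

/-- The state `ρ ⊗ V σ V†` measured in the state-learning scheme, where `σ = ρ^(U)` and `V` is the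
linear-optical circuit of `U`. -/
def stateLearningState {n : ℕ} (ρ σ V : Op (ModeSpace n)) : Op (PairSpace n) :=
  opTensor ρ (conjOp V σ)

/-! ### Bell measurement -/

/-- `χ_τ(α, α*) = Tr[τ (D(α) ⊗ D(α*))]`. -/
def bellSlice {n : ℕ} (τ : Op (PairSpace n)) (α : Phase n) : ℂ :=
  opTrace (τ ∘L opTensor (displacement α) (displacement (star α)))

/-- `f` is the probability density of the outcome `ζ ∈ ℂⁿ` of the continuous-variable Bell
measurement on `τ`, whose POVM is
`Π(ζ) = π^{-n} (1 ⊗ D(ζ))|Ψ⟩⟨Ψ|(1 ⊗ D(ζ)†) = π^{-2n} ∫ dα e^{ζ·α - ζ*·α*} D(α) ⊗ D(α*)`.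
That is: `f(ζ) = Tr[Π(ζ) τ] = π^{-2n} ∫ dα e^{ζ·α - ζ*·α*} Tr[τ (D(α) ⊗ D(α*))]` for every `ζ`, with a
convergent integral; `f` is a probability density; and the outcome distribution is the joint
spectral distribution in `τ` of the commuting unitaries
`D(α) ⊗ D(α*) = ∫ dζ e^{ζ*·α* - ζ·α} Π(ζ)`. -/
structure IsBellDensity {n : ℕ} (τ : Op (PairSpace n)) (f : Phase n → ℝ) : Prop where
  integrable_slice : Integrable (bellSlice τ)
  density_eq : ∀ ζ : Phase n, (f ζ : ℂ) =
    ((π : ℂ) ^ (2 * n))⁻¹ *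
      ∫ α : Phase n, Complex.exp (ζ ⬝ᵥ α - star ζ ⬝ᵥ star α) * bellSlice τ α
  nonneg : ∀ ζ, 0 ≤ f ζ
  integrable : Integrable f
  integral_eq_one : ∫ ζ, f ζ = 1
  spectral : ∀ α : Phase n,
    ∫ ζ : Phase n, Complex.exp (star ζ ⬝ᵥ star α - ζ ⬝ᵥ α) * (f ζ : ℂ) = bellSlice τ α

/-! ### Gaussian noise -/

/-- The centred isotropic complex Gaussian on `ℂⁿ` with `E|Nᵢ|² = c` (density
`(πc)^{-n} e^{-|β|²/c}`; Dirac mass at `0` if `c = 0`): the `2n` real and imaginary parts are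
independent with variance `c / 2`. -/
def complexGaussian (n : ℕ) (c : ℝ≥0) : Measure (Phase n) :=
  Measure.pi fun _ : Fin n =>
    ((ProbabilityTheory.gaussianReal 0 (c / 2)).prod
      (ProbabilityTheory.gaussianReal 0 (c / 2))).map Complex.measurableEquivRealProd.symm

end BosonicLearning

end

noncomputable section

namespace BosonicLearning

/-! ### Hilbert–Schmidt operators and the trace -/

section HilbertSchmidt

variable {K : Type*} [NormedAddCommGroup K] [InnerProductSpace ℂ K] [CompleteSpace K]
  {ι κ : Type*}

/-! Everything the Bell measurement sees of a two-register state `τ` is the slice `χ_τ(α, α*) = Tr[τ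
(D(α) ⊗ D(α*))]`; the outcome density is its Fourier transform. So it suffices to show that the two
schemes have the same slice and that this slice is the transform of a probability density. Write `s
= s_max`, `W = W_ρ(s)`, and `Ŵ` for the integral of `sympChar` against `W`.

State scheme: the trace factors over the registers, the circuit turns `D(α*)` into `D(Uᵀ α*)`, and
reflection then gives `χ_ρ(U U† α) = χ_ρ(α)`. The slice is `χ_ρ(α)² = e^{-s|α|²} Ŵ(α)²`
(`bellSlice_stateLearningState_eq_sq`, `IsNonnegQPD.charFn_sq_eq`).

Channel scheme: by the Weyl relations a displacement by `β` multiplies `D(α)` by the phase `sympChar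
β α`, so averaging over `p` multiplies the slice of the squeezed vacuum by `p̂(α)`. That slice is
`e^{-e^{-2r}|α|²}` (`inner_tmsv`): in the number basis it is the sum of `t^{|j|+|k|} |⟨j|D(α)|k⟩|²`
with `t = tanh r`, evaluated by Mehler's formula. For `p = W * W * 𝒩_{s - e^{-2r}}` the Gaussian
exponents add up to `s`, whatever `r` is, and the slices agree.

Density: `s > 0` makes the common slice Gaussian-damped, hence integrable, and its transform is a
reflection of `(W * W) * 𝒩_s`, which is manifestly a probability density
(`isBellDensity_smoothedDensity`).

That `W` exists, i.e. that the supremum `s_max` is attained, is Lévy continuity: the ordered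
characteristic functions converge pointwise to a continuous limit along a sequence `s_k → s_max`.

The operator-theoretic layer handles the trace through products of two Hilbert–Schmidt operators,
for which it is cyclic and basis independent; a state is such a product, being the square of its
square root. -/

omit [CompleteSpace K] in
theorem hasSum_norm_inner_sq (b : HilbertBasis ι ℂ K) (x : K) :
    HasSum (fun i => ‖⟪b i, x⟫_ℂ‖ ^ 2) (‖x‖ ^ 2) := by
  have h := b.hasSum_inner_mul_inner x x
  have e : ∀ i, ⟪x, b i⟫_ℂ * ⟪b i, x⟫_ℂ = ((‖⟪b i, x⟫_ℂ‖ ^ 2 : ℝ) : ℂ) := fun i => by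
    rw [← inner_conj_symm x (b i), Complex.conj_mul']
    push_cast
    rfl
  simp_rw [e, inner_self_eq_norm_sq_to_K] at h
  have h2 : HasSum (fun i => ((‖⟪b i, x⟫_ℂ‖ ^ 2 : ℝ) : ℂ)) ((‖x‖ ^ 2 : ℝ) : ℂ) := by
    simpa using h
  exact_mod_cast h2

omit [CompleteSpace K] in
theorem summable_prod_norm_inner_sq (b : HilbertBasis ι ℂ K) (c : HilbertBasis κ ℂ K) {T : Op K}
    (h : Summable fun i => ‖T (b i)‖ ^ 2) :
    Summable fun p : ι × κ => ‖⟪c p.2, T (b p.1)⟫_ℂ‖ ^ 2 := by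
  have h0 : 0 ≤ fun p : ι × κ => ‖⟪c p.2, T (b p.1)⟫_ℂ‖ ^ 2 := fun p => sq_nonneg _
  have e : ∀ i, ∑' j, ‖⟪c j, T (b i)⟫_ℂ‖ ^ 2 = ‖T (b i)‖ ^ 2 := fun i =>
    (hasSum_norm_inner_sq c (T (b i))).tsum_eq
  rw [summable_prod_of_nonneg h0]
  refine ⟨fun i => (hasSum_norm_inner_sq c (T (b i))).summable, ?_⟩
  simp_rw [e]
  exact h

/-- Both series sum the same squared matrix entries, by columns or by rows. Since the two bases may
differ, this one exchange also yields basis independence. -/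
theorem summable_norm_adjoint_sq (b : HilbertBasis ι ℂ K) (c : HilbertBasis κ ℂ K) {T : Op K}
    (h : Summable fun i => ‖T (b i)‖ ^ 2) :
    Summable fun j => ‖ContinuousLinearMap.adjoint T (c j)‖ ^ 2 := by
  have h1 := (summable_prod_norm_inner_sq b c h).prod_symm
  have h2 := (summable_prod_of_nonneg fun p => sq_nonneg _).1 h1
  refine h2.2.congr fun j => ?_
  rw [← (hasSum_norm_inner_sq b (ContinuousLinearMap.adjoint T (c j))).tsum_eq]
  refine tsum_congr fun i => ?_
  rw [ContinuousLinearMap.adjoint_inner_right, norm_inner_symm]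
  rfl

variable (K) in
/-- The orthonormal basis in which `opTrace` is computed. -/
def traceBasis : HilbertBasis (exists_hilbertBasis ℂ K).choose ℂ K :=
  (exists_hilbertBasis ℂ K).choose_spec.choose

/-- Hilbert–Schmidt operators. -/
def IsHilbertSchmidt (T : Op K) : Prop := Summable fun i => ‖T (traceBasis K i)‖ ^ 2

theorem IsHilbertSchmidt.adjoint {T : Op K} (h : IsHilbertSchmidt T) :
    IsHilbertSchmidt (ContinuousLinearMap.adjoint T) :=
  summable_norm_adjoint_sq _ _ h

theorem IsHilbertSchmidt.summable {T : Op K} (h : IsHilbertSchmidt T) (b : HilbertBasis ι ℂ K) :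
    Summable fun i => ‖T (b i)‖ ^ 2 := by
  simpa using summable_norm_adjoint_sq (traceBasis K) b h.adjoint

theorem IsHilbertSchmidt.of_summable {T : Op K} (b : HilbertBasis ι ℂ K)
    (h : Summable fun i => ‖T (b i)‖ ^ 2) : IsHilbertSchmidt T := by
  have := summable_norm_adjoint_sq (traceBasis K) (traceBasis K)
    (summable_norm_adjoint_sq b (traceBasis K) h)
  rwa [ContinuousLinearMap.adjoint_adjoint] at this

theorem IsHilbertSchmidt.comp_left {T : Op K} (h : IsHilbertSchmidt T) (S : Op K) :
    IsHilbertSchmidt (S ∘L T) := by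
  refine Summable.of_nonneg_of_le (fun _ => by positivity) (fun i => ?_)
    (Summable.mul_left (‖S‖ ^ 2) h)
  rw [← mul_pow]
  exact pow_le_pow_left₀ (norm_nonneg _) (S.le_opNorm _) 2

theorem IsHilbertSchmidt.comp_right {T : Op K} (h : IsHilbertSchmidt T) (S : Op K) :
    IsHilbertSchmidt (T ∘L S) := by
  have := (h.adjoint.comp_left (ContinuousLinearMap.adjoint S)).adjoint
  simpa [ContinuousLinearMap.adjoint_comp] using this

/-- Domination of `|ab|` by `|a|² + |b|²` gives the absolute convergence that permits interchanging
the two sums in the proof of cyclicity. -/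
theorem summable_inner_mul_inner_prod (b : HilbertBasis ι ℂ K) (c : HilbertBasis κ ℂ K)
    {A B : Op K} (hA : IsHilbertSchmidt A) (hB : IsHilbertSchmidt B) :
    Summable fun p : ι × κ =>
      ⟪ContinuousLinearMap.adjoint A (b p.1), c p.2⟫_ℂ * ⟪c p.2, B (b p.1)⟫_ℂ := by
  have h1 := summable_prod_norm_inner_sq b c (hA.adjoint.summable b)
  have h2 := summable_prod_norm_inner_sq b c (hB.summable b)
  refine Summable.of_norm_bounded (h1.add h2) fun p => ?_
  rw [norm_mul, norm_inner_symm]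
  nlinarith [sq_nonneg (‖⟪c p.2, ContinuousLinearMap.adjoint A (b p.1)⟫_ℂ‖ - ‖⟪c p.2, B (b p.1)⟫_ℂ‖),
    sq_nonneg (‖⟪c p.2, ContinuousLinearMap.adjoint A (b p.1)⟫_ℂ‖),
    sq_nonneg (‖⟪c p.2, B (b p.1)⟫_ℂ‖)]

theorem summable_inner_comp (b : HilbertBasis ι ℂ K)
    {A B : Op K} (hA : IsHilbertSchmidt A) (hB : IsHilbertSchmidt B) :
    Summable fun i => ⟪b i, (A ∘L B) (b i)⟫_ℂ := by
  have h := (summable_inner_mul_inner_prod b b hA hB).prod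
  refine h.congr fun i => ?_
  refine (b.tsum_inner_mul_inner (ContinuousLinearMap.adjoint A (b i)) (B (b i))).trans ?_
  rw [ContinuousLinearMap.adjoint_inner_left]
  rfl

/-- Insert a resolution of the identity in `c`, swap the sums, and resum over `b`. Allowing
different bases gives cyclicity and basis independence at once. -/
theorem tsum_inner_comp_comm (b : HilbertBasis ι ℂ K) (c : HilbertBasis κ ℂ K)
    {A B : Op K} (hA : IsHilbertSchmidt A) (hB : IsHilbertSchmidt B) :
    ∑' i, ⟪b i, (A ∘L B) (b i)⟫_ℂ = ∑' j, ⟪c j, (B ∘L A) (c j)⟫_ℂ := by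
  have h := summable_inner_mul_inner_prod b c hA hB
  have h' := h.tsum_comm (f := fun i j =>
    ⟪ContinuousLinearMap.adjoint A (b i), c j⟫_ℂ * ⟪c j, B (b i)⟫_ℂ)
  have e1 : ∀ i, ∑' j, ⟪ContinuousLinearMap.adjoint A (b i), c j⟫_ℂ * ⟪c j, B (b i)⟫_ℂ =
      ⟪b i, (A ∘L B) (b i)⟫_ℂ := fun i => by
    rw [c.tsum_inner_mul_inner, ContinuousLinearMap.adjoint_inner_left]
    rfl
  have e2 : ∀ j, ∑' i, ⟪ContinuousLinearMap.adjoint A (b i), c j⟫_ℂ * ⟪c j, B (b i)⟫_ℂ =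
      ⟪c j, (B ∘L A) (c j)⟫_ℂ := fun j => by
    rw [ContinuousLinearMap.comp_apply, ← ContinuousLinearMap.adjoint_inner_left,
      ← b.tsum_inner_mul_inner]
    refine tsum_congr fun i => ?_
    rw [ContinuousLinearMap.adjoint_inner_left, ContinuousLinearMap.adjoint_inner_left, mul_comm]
  simp_rw [e1, e2] at h'
  exact h'.symm

theorem opTrace_comp_comm {A B : Op K} (hA : IsHilbertSchmidt A) (hB : IsHilbertSchmidt B) :
    opTrace (A ∘L B) = opTrace (B ∘L A) :=
  tsum_inner_comp_comm (traceBasis K) (traceBasis K) hA hB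

theorem opTrace_comp_eq_tsum (b : HilbertBasis ι ℂ K)
    {A B : Op K} (hA : IsHilbertSchmidt A) (hB : IsHilbertSchmidt B) :
    opTrace (A ∘L B) = ∑' i, ⟪b i, (A ∘L B) (b i)⟫_ℂ := by
  rw [opTrace_comp_comm hA hB]
  exact tsum_inner_comp_comm (traceBasis K) b hB hA

/-- A state is the square of a self-adjoint Hilbert–Schmidt operator. -/
theorem IsState.exists_sqrt {ρ : Op K} (h : IsState ρ) :
    ∃ S : Op K, IsHilbertSchmidt S ∧ S ∘L S = ρ := by
  have hρ : 0 ≤ ρ := (ContinuousLinearMap.nonneg_iff_isPositive ρ).2 h.isPositive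
  refine ⟨CFC.sqrt ρ, ?_, CFC.sqrt_mul_sqrt_self ρ hρ⟩
  have hS : ContinuousLinearMap.adjoint (CFC.sqrt ρ) = CFC.sqrt ρ :=
    (CFC.sqrt_nonneg ρ).isSelfAdjoint
  have hs : Summable fun i => ⟪traceBasis K i, ρ (traceBasis K i)⟫_ℂ := by
    -- A divergent `tsum` has the default value 0, so trace one forces convergence.
    by_contra hn
    have := h.trace_eq_one
    exact zero_ne_one ((tsum_eq_zero_of_not_summable hn).symm.trans this)
  have e : ∀ i, ⟪traceBasis K i, ρ (traceBasis K i)⟫_ℂ =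
      ((‖CFC.sqrt ρ (traceBasis K i)‖ ^ 2 : ℝ) : ℂ) := fun i => by
    conv_lhs => rw [← CFC.sqrt_mul_sqrt_self ρ hρ]
    rw [mul_apply_eq_comp, ← ContinuousLinearMap.adjoint_inner_left, hS,
      inner_self_eq_norm_sq_to_K]
    push_cast
    rfl
  simp_rw [e] at hs
  exact_mod_cast hs

end HilbertSchmidt

/-- Distinct basis vectors are at distance at least 1, so balls of radius 1/2 around them are
disjoint, and a separable space holds only countably many. Countability is what lets dominated
convergence exchange the trace with an integral. -/
theorem countable_of_hilbertBasis {K ι : Type*} [NormedAddCommGroup K] [InnerProductSpace ℂ K]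
    [TopologicalSpace.SeparableSpace K] (b : HilbertBasis ι ℂ K) : Countable ι := by
  have hd : ∀ i j, i ≠ j → (1 : ℝ) ≤ dist (b i) (b j) := fun i j hij => by
    have h := norm_sub_sq (𝕜 := ℂ) (b i) (b j)
    rw [b.orthonormal.1 i, b.orthonormal.1 j, b.orthonormal.2 hij, map_zero] at h
    rw [dist_eq_norm]
    nlinarith [norm_nonneg (b i - b j)]
  have h : (Set.univ : Set ι).PairwiseDisjoint fun i => Metric.ball (b i) (1 / 2) :=
    fun i _ j _ hij => Metric.ball_disjoint_ball (by linarith [hd i j hij])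
  exact Set.countable_univ_iff.1 (h.countable_of_isOpen (fun _ _ => Metric.isOpen_ball)
    fun i _ => ⟨b i, Metric.mem_ball_self (by norm_num)⟩)

/-! ### Operators on two registers -/

section Pair

variable {n : ℕ} {ι κ : Type*}

theorem inner_vecTensor (f g f' g' : ModeSpace n) :
    ⟪vecTensor f g, vecTensor f' g'⟫_ℂ = ⟪f, f'⟫_ℂ * ⟪g, g'⟫_ℂ := by
  simp [vecTensor, UniformSpace.Completion.inner_coe]

theorem norm_vecTensor (f g : ModeSpace n) : ‖vecTensor f g‖ = ‖f‖ * ‖g‖ := by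
  simp [vecTensor, UniformSpace.Completion.norm_coe]

variable (n) in
/-- The product vector `f ⊗ g` as a continuous bilinear map. -/
def vecTensorL : ModeSpace n →L[ℂ] ModeSpace n →L[ℂ] PairSpace n :=
  LinearMap.mkContinuous₂
    (LinearMap.mk₂ ℂ vecTensor
      (fun a b c => by simp [vecTensor, TensorProduct.add_tmul, UniformSpace.Completion.coe_add])
      (fun a b c => by
        simp [vecTensor, ← TensorProduct.smul_tmul', UniformSpace.Completion.coe_smul])
      (fun a b c => by simp [vecTensor, TensorProduct.tmul_add, UniformSpace.Completion.coe_add])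
      (fun a b c => by simp [vecTensor, UniformSpace.Completion.coe_smul]))
    1 fun f g => by rw [one_mul]; exact (norm_vecTensor f g).le

@[simp]
theorem vecTensorL_apply (f g : ModeSpace n) : vecTensorL n f g = vecTensor f g := rfl

theorem topologicalClosure_span_vecTensor :
    (Submodule.span ℂ (Set.range fun p : ModeSpace n × ModeSpace n =>
      vecTensor p.1 p.2)).topologicalClosure = ⊤ := by
  rw [← Submodule.dense_iff_topologicalClosure_eq_top]
  refine (UniformSpace.Completion.denseRange_coe
    (α := ModeSpace n ⊗[ℂ] ModeSpace n)).mono ?_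
  rintro _ ⟨x, rfl⟩
  induction x using TensorProduct.induction_on with
  | zero => rw [UniformSpace.Completion.coe_zero]; exact Submodule.zero_mem _
  | tmul f g => exact Submodule.subset_span ⟨(f, g), rfl⟩
  | add x y hx hy => rw [UniformSpace.Completion.coe_add]; exact Submodule.add_mem _ hx hy

/-- Product vectors span a dense subspace, so identities between bounded operators on two registers
need checking on them only. -/
theorem continuousLinearMap_ext_vecTensor {F : Type*} [NormedAddCommGroup F] [NormedSpace ℂ F]
    {A B : PairSpace n →L[ℂ] F} (h : ∀ f g, A (vecTensor f g) = B (vecTensor f g)) : A = B := by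
  refine ContinuousLinearMap.ext_on
    (Submodule.dense_iff_topologicalClosure_eq_top.2 topologicalClosure_span_vecTensor) ?_
  rintro _ ⟨p, rfl⟩
  exact h _ _

theorem opTensor_comp (A B A' B' : Op (ModeSpace n)) :
    opTensor A B ∘L opTensor A' B' = opTensor (A ∘L A') (B ∘L B') :=
  continuousLinearMap_ext_vecTensor fun f g => by simp [opTensor_vecTensor]

theorem adjoint_opTensor (A B : Op (ModeSpace n)) :
    ContinuousLinearMap.adjoint (opTensor A B) =
      opTensor (ContinuousLinearMap.adjoint A) (ContinuousLinearMap.adjoint B) := by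
  symm
  refine continuousLinearMap_ext_vecTensor fun f g => ?_
  have h : innerSL ℂ (opTensor (ContinuousLinearMap.adjoint A) (ContinuousLinearMap.adjoint B)
      (vecTensor f g)) =
      innerSL ℂ (ContinuousLinearMap.adjoint (opTensor A B) (vecTensor f g)) :=
    continuousLinearMap_ext_vecTensor fun f' g' => by
      simp only [innerSL_apply_apply, ContinuousLinearMap.adjoint_inner_left, opTensor_vecTensor,
        inner_vecTensor]
  exact ext_inner_right ℂ fun v => congrArg (fun L => L v) h

/-- The product of two orthonormal bases. -/
def pairBasis (b : HilbertBasis ι ℂ (ModeSpace n)) (c : HilbertBasis κ ℂ (ModeSpace n)) :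
    HilbertBasis (ι × κ) ℂ (PairSpace n) :=
  HilbertBasis.mk (v := fun p : ι × κ => vecTensor (b p.1) (c p.2))
    (by
      classical
      rw [orthonormal_iff_ite]
      rintro ⟨i, j⟩ ⟨i', j'⟩
      rw [inner_vecTensor, orthonormal_iff_ite.1 b.orthonormal, orthonormal_iff_ite.1 c.orthonormal]
      by_cases h1 : i = i' <;> by_cases h2 : j = j' <;> simp [h1, h2])
    (by
      set S : Submodule ℂ (PairSpace n) := (Submodule.span ℂ (Set.range
        fun p : ι × κ => vecTensor (b p.1) (c p.2))).topologicalClosure with hS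
      have hSc : IsClosed (S : Set (PairSpace n)) := Submodule.isClosed_topologicalClosure _
      have h0 : ∀ i j, vecTensor (b i) (c j) ∈ S := fun i j =>
        Submodule.le_topologicalClosure _ (Submodule.subset_span ⟨(i, j), rfl⟩)
      -- The closed span absorbs one slot at a time: expand `f` in `b` with `c j` fixed, then `g` in
      -- `c`.
      have h1 : ∀ f j, vecTensor f (c j) ∈ S := fun f j => by
        have hs := (b.hasSum_repr f).mapL ((vecTensorL n).flip (c j))
        refine hSc.mem_of_tendsto hs (Filter.Eventually.of_forall fun s => ?_)
        refine Submodule.sum_mem _ fun i _ => ?_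
        rw [map_smul]
        exact Submodule.smul_mem _ _ (h0 i j)
      have h2 : ∀ f g, vecTensor f g ∈ S := fun f g => by
        have hs := (c.hasSum_repr g).mapL (vecTensorL n f)
        refine hSc.mem_of_tendsto hs (Filter.Eventually.of_forall fun s => ?_)
        refine Submodule.sum_mem _ fun i _ => ?_
        rw [map_smul]
        exact Submodule.smul_mem _ _ (h1 f i)
      rw [← topologicalClosure_span_vecTensor]
      refine Submodule.topologicalClosure_minimal _ (Submodule.span_le.2 ?_) hSc
      rintro _ ⟨p, rfl⟩
      exact h2 _ _)

theorem pairBasis_apply (b : HilbertBasis ι ℂ (ModeSpace n)) (c : HilbertBasis κ ℂ (ModeSpace n))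
    (p : ι × κ) : pairBasis b c p = vecTensor (b p.1) (c p.2) := by
  rw [pairBasis, HilbertBasis.coe_mk]

theorem IsHilbertSchmidt.opTensor {A B : Op (ModeSpace n)} (hA : IsHilbertSchmidt A)
    (hB : IsHilbertSchmidt B) : IsHilbertSchmidt (opTensor A B) := by
  refine IsHilbertSchmidt.of_summable
    (pairBasis (traceBasis (ModeSpace n)) (traceBasis (ModeSpace n))) ?_
  have h := Summable.mul_of_nonneg hA hB (fun _ => sq_nonneg _) (fun _ => sq_nonneg _)
  refine h.congr fun p => ?_
  rw [pairBasis_apply, opTensor_vecTensor, norm_vecTensor, mul_pow]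

/-- In the product basis the diagonal entries factor, and the double series converges absolutely.
Each factor is given as a product of Hilbert–Schmidt operators so that the traces may be computed in
these bases. -/
theorem opTrace_opTensor {A A' B B' : Op (ModeSpace n)} (hA : IsHilbertSchmidt A)
    (hA' : IsHilbertSchmidt A') (hB : IsHilbertSchmidt B) (hB' : IsHilbertSchmidt B') :
    opTrace (opTensor (A ∘L A') (B ∘L B')) = opTrace (A ∘L A') * opTrace (B ∘L B') := by
  have b := traceBasis (ModeSpace n)
  rw [← opTensor_comp, opTrace_comp_eq_tsum (pairBasis b b) (hA.opTensor hB) (hA'.opTensor hB'),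
    opTrace_comp_eq_tsum b hA hA', opTrace_comp_eq_tsum b hB hB',
    tsum_mul_tsum_of_summable_norm (summable_inner_comp b hA hA').norm
      (summable_inner_comp b hB hB').norm]
  refine tsum_congr fun p => ?_
  rw [pairBasis_apply, opTensor_comp, opTensor_vecTensor, inner_vecTensor]

/-- Splitting both states as squares of Hilbert–Schmidt operators makes the trace factor over the
registers; cyclicity then carries `V` round to meet `V† D(α*)`, producing `V† D(α*) V = D(Uᵀ α*)`.
-/
theorem bellSlice_stateLearningState {U : Matrix (Fin n) (Fin n) ℂ} {ρ σ V : Op (ModeSpace n)}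
    (hρ : IsState ρ) (hσ : IsState σ) (hV : IsPassiveUnitary U V) (α : Phase n) :
    bellSlice (stateLearningState ρ σ V) α =
      charFn ρ α * charFn σ (U.transpose.mulVec (star α)) := by
  obtain ⟨S, hS, rfl⟩ := hρ.exists_sqrt
  obtain ⟨R, hR, rfl⟩ := hσ.exists_sqrt
  set D := displacement (star α)
  set V' := ContinuousLinearMap.adjoint V
  have e : stateLearningState (S ∘L S) (R ∘L R) V ∘L opTensor (displacement α) D =
      opTensor (S ∘L (S ∘L displacement α)) ((V ∘L R) ∘L (R ∘L V' ∘L D)) := by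
    rw [stateLearningState, opTensor_comp]
    rfl
  have e2 : opTrace ((V ∘L R) ∘L (R ∘L V' ∘L D)) =
      opTrace ((R ∘L R) ∘L displacement (U.transpose.mulVec (star α))) := by
    rw [← hV.2, opTrace_comp_comm (hR.comp_left V) (hR.comp_right _)]
    exact opTrace_comp_comm (hR.comp_right (V' ∘L D ∘L V)) hR
  rw [bellSlice, e, opTrace_opTensor hS (hS.comp_right _) (hR.comp_left V) (hR.comp_right _), e2]
  rfl

/-- Conjugating `Uᵀ α*` gives `U† α`, which `U` undoes. -/
theorem mulVec_star_transpose_mulVec_star {U : Matrix (Fin n) (Fin n) ℂ}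
    (hU : U ∈ Matrix.unitaryGroup (Fin n) ℂ) (α : Phase n) :
    U.mulVec (star (U.transpose.mulVec (star α))) = α := by
  have : star (U.transpose.mulVec (star α)) = (star U).mulVec α := by
    rw [Matrix.star_mulVec, star_star, Matrix.conjTranspose, Matrix.transpose_transpose,
      ← Matrix.mulVec_transpose]
    rfl
  rw [this, Matrix.mulVec_mulVec, Matrix.mem_unitaryGroup_iff.1 hU, Matrix.one_mulVec]

theorem bellSlice_stateLearningState_eq_sq {U : Matrix (Fin n) (Fin n) ℂ}
    (hU : U ∈ Matrix.unitaryGroup (Fin n) ℂ) {ρ σ V : Op (ModeSpace n)}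
    (hρ : IsState ρ) (hσ : IsReflectedState U ρ σ) (hV : IsPassiveUnitary U V) (α : Phase n) :
    bellSlice (stateLearningState ρ σ V) α = charFn ρ α ^ 2 := by
  rw [bellSlice_stateLearningState hρ hσ.1 hV, hσ.2, mulVec_star_transpose_mulVec_star hU, sq]

theorem separableSpace_pairSpace : TopologicalSpace.SeparableSpace (PairSpace n) := by
  have : Fact ((2 : ℝ≥0∞) ≠ ∞) := ⟨by simp⟩
  have h1 : Continuous fun p : ModeSpace n × ModeSpace n => vecTensor p.1 p.2 :=
    (vecTensorL n).continuous₂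
  have h2 := (TopologicalSpace.isSeparable_range h1).span (R := ℂ)
  have h3 := h2.closure
  rw [← Submodule.topologicalClosure_coe, topologicalClosure_span_vecTensor] at h3
  exact TopologicalSpace.isSeparable_univ_iff.1 h3

end Pair

/-! ### The Weyl relations and strong continuity -/

section Displacement

variable {n : ℕ}

theorem norm_translation (c : Fin n → ℝ) (f : ModeSpace n) : ‖translation c f‖ = ‖f‖ :=
  LinearIsometry.norm_map _ f

theorem norm_displacement_apply (α : Phase n) (f : ModeSpace n) : ‖displacement α f‖ = ‖f‖ := by
  rw [← norm_translation (fun j => √2 * (α j).re) f, Lp.norm_def, Lp.norm_def]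
  congr 1
  refine eLpNorm_congr_norm_ae ?_
  have h2 : (translation (fun j => √2 * (α j).re) f : (Fin n → ℝ) → ℂ) =ᵐ[volume]
      (f : (Fin n → ℝ) → ℂ) ∘ fun x => x - fun j => √2 * (α j).re :=
    Lp.coeFn_compMeasurePreserving f (measurePreserving_sub_right volume _)
  filter_upwards [displacement_ae α f, h2] with x h1 h2
  rw [h1, h2, norm_mul, norm_displacementPhase, one_mul]
  rfl

theorem adjoint_displacement_comp_self (α : Phase n) :
    ContinuousLinearMap.adjoint (displacement α) ∘L displacement α = 1 :=
  (ContinuousLinearMap.norm_map_iff_adjoint_comp_self _).1 (norm_displacement_apply α)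

theorem displacement_comp_ae (α β : Phase n) (f : ModeSpace n) :
    (displacement α (displacement β f) : (Fin n → ℝ) → ℂ) =ᵐ[volume] fun x =>
      displacementPhase α x * (displacementPhase β (x - fun j => √2 * (α j).re) *
        f ((x - fun j => √2 * (α j).re) - fun j => √2 * (β j).re)) := by
  have h := (measurePreserving_sub_right (volume : Measure (Fin n → ℝ))
    (fun j => √2 * (α j).re)).quasiMeasurePreserving.ae_eq_comp (displacement_ae β f)
  filter_upwards [displacement_ae α (displacement β f), h] with x h1 h2
  rw [h1]
  congr 1

/-- The exponent is a complex number minus its conjugate, hence `2i` times the real symplectic form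
of `β` and `α`. -/
theorem sympChar_eq_exp (β α : Phase n) :
    sympChar β α =
      Complex.exp (((∑ j, 2 * ((β j).re * (α j).im - (β j).im * (α j).re) : ℝ) : ℂ) *
        Complex.I) := by
  rw [sympChar]
  congr 1
  simp only [dotProduct, Pi.star_apply, Complex.ofReal_sum, Finset.sum_mul,
    ← Finset.sum_sub_distrib]
  refine Finset.sum_congr rfl fun j _ => ?_
  apply Complex.ext <;> simp <;> ring

theorem displacement_comp_comm (α β : Phase n) :
    displacement α ∘L displacement β = sympChar β α • (displacement β ∘L displacement α) := by
  ext1 f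
  refine Lp.ext ?_
  simp only [ContinuousLinearMap.comp_apply, smul_apply]
  filter_upwards [displacement_comp_ae α β f, displacement_comp_ae β α f,
    Lp.coeFn_smul (sympChar β α) (displacement β (displacement α f))] with x h1 h2 h3
  rw [h1, h3, Pi.smul_apply, h2, smul_eq_mul, sub_right_comm, ← mul_assoc, ← mul_assoc, ← mul_assoc]
  congr 1
  rw [sympChar_eq_exp]
  simp only [displacementPhase]
  rw [← Complex.exp_add, ← Complex.exp_add, ← Complex.exp_add, ← add_mul, ← add_mul, ← add_mul,
    ← Complex.ofReal_add, ← Complex.ofReal_add, ← Complex.ofReal_add, ← Finset.sum_add_distrib,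
    ← Finset.sum_add_distrib, ← Finset.sum_add_distrib]
  congr 3
  refine Finset.sum_congr rfl fun j _ => ?_
  simp only [Pi.sub_apply]
  have h2 : √2 * √2 = 2 := Real.mul_self_sqrt (by norm_num)
  -- Only the cross terms, created when one translation shifts the other's phase, depend on the
  -- order; there the two factors `√2` combine to 2.
  linear_combination (-(β j).im * (α j).re + (α j).im * (β j).re) * h2

/-- This covariance makes a random displacement act on characteristic functions by multiplication.
-/
theorem displacement_conj (α β : Phase n) :
    ContinuousLinearMap.adjoint (displacement β) ∘L displacement α ∘L displacement β =
      sympChar β α • displacement α := by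
  rw [displacement_comp_comm, ContinuousLinearMap.comp_smul, ← ContinuousLinearMap.comp_assoc,
    adjoint_displacement_comp_self]
  rfl

theorem continuous_translation_apply (f : ModeSpace n) :
    Continuous fun c : Fin n → ℝ => translation c f := by
  have h : Continuous fun c : Fin n → ℝ => (⟨fun x => x - c, by fun_prop⟩ : C(Fin n → ℝ, Fin n → ℝ)) :=
    ContinuousMap.continuous_of_continuous_uncurry _ (by
      simp only [Function.uncurry_def, ContinuousMap.coe_mk]
      fun_prop)
  exact (continuous_const (y := f)).compMeasurePreservingLp h
    (fun c => measurePreserving_sub_right volume c) (by simp)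

/-- Multiplication by the phase of `displacement α`. -/
def phaseMul (α : Phase n) : Op (ModeSpace n) :=
  (ContinuousLinearMap.mul ℂ ℂ).holderL volume ∞ 2 2 (memLp_displacementPhase α).toLp

theorem phaseMul_ae (α : Phase n) (f : ModeSpace n) :
    (phaseMul α f : (Fin n → ℝ) → ℂ) =ᵐ[volume] fun x => displacementPhase α x * f x := by
  have h1 : (phaseMul α f : (Fin n → ℝ) → ℂ) =ᵐ[volume] _ :=
    (ContinuousLinearMap.mul ℂ ℂ).coeFn_holder (r := 2) (memLp_displacementPhase α).toLp f
  filter_upwards [h1, (memLp_displacementPhase α).coeFn_toLp] with x a c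
  rw [a, c]
  rfl

theorem norm_phaseMul_apply (α : Phase n) (f : ModeSpace n) : ‖phaseMul α f‖ = ‖f‖ := by
  rw [Lp.norm_def, Lp.norm_def]
  congr 1
  refine eLpNorm_congr_norm_ae ?_
  filter_upwards [phaseMul_ae α f] with x h1
  rw [h1, norm_mul, norm_displacementPhase, one_mul]

theorem norm_sq_eq_integral (f : ModeSpace n) : ‖f‖ ^ 2 = ∫ x, ‖f x‖ ^ 2 := by
  have h := @inner_self_eq_norm_sq_to_K ℂ (ModeSpace n) _ _ _ f
  rw [L2.inner_def] at h
  have e : ∀ x, ⟪f x, f x⟫_ℂ = ((‖f x‖ ^ 2 : ℝ) : ℂ) := fun x => by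
    rw [inner_self_eq_norm_sq_to_K]
    push_cast
    rfl
  simp_rw [e] at h
  rw [integral_complex_ofReal] at h
  have h' : ((∫ x, ‖f x‖ ^ 2 : ℝ) : ℂ) = ((‖f‖ ^ 2 : ℝ) : ℂ) := by
    rw [Complex.ofReal_pow]
    exact h
  exact_mod_cast h'.symm

/-- The squared distance is the integral of `|phase difference|² |f|²`, dominated by `4|f|²`, so
dominated convergence applies. -/
theorem continuous_phaseMul_apply (f : ModeSpace n) :
    Continuous fun α : Phase n => phaseMul α f := by
  rw [continuous_iff_continuousAt]
  intro α₀
  have hph : ∀ x : Fin n → ℝ, Continuous fun α : Phase n => displacementPhase α x := fun x => by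
    unfold displacementPhase
    fun_prop
  have hI : Integrable (fun x => ‖f x‖ ^ 2) (volume : Measure (Fin n → ℝ)) :=
    (Lp.memLp f).integrable_norm_pow (by simp)
  have hc : Continuous fun α : Phase n =>
      ∫ x, ‖(displacementPhase α x - displacementPhase α₀ x) * f x‖ ^ 2 := by
    refine continuous_of_dominated (bound := fun x => 4 * ‖f x‖ ^ 2) (fun α => ?_)
      (fun α => Filter.Eventually.of_forall fun x => ?_) (hI.const_mul 4)
      (Filter.Eventually.of_forall fun x => ?_)
    · have := (((continuous_displacementPhase α).sub
        (continuous_displacementPhase α₀)).aestronglyMeasurable.mul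
        (Lp.aestronglyMeasurable f)).norm.pow 2
      exact this
    · rw [Real.norm_of_nonneg (by positivity), norm_mul, mul_pow]
      refine mul_le_mul_of_nonneg_right ?_ (by positivity)
      have h := norm_sub_le (displacementPhase α x) (displacementPhase α₀ x)
      rw [norm_displacementPhase, norm_displacementPhase] at h
      nlinarith [norm_nonneg (displacementPhase α x - displacementPhase α₀ x)]
    · have := hph x
      fun_prop
  have he : ∀ α : Phase n, ‖phaseMul α f - phaseMul α₀ f‖ ^ 2 =
      ∫ x, ‖(displacementPhase α x - displacementPhase α₀ x) * f x‖ ^ 2 := fun α => by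
    rw [norm_sq_eq_integral]
    refine integral_congr_ae ?_
    filter_upwards [phaseMul_ae α f, phaseMul_ae α₀ f,
      Lp.coeFn_sub (phaseMul α f) (phaseMul α₀ f)] with x h1 h2 h3
    rw [h3, Pi.sub_apply, h1, h2, sub_mul]
  have h0 := hc.tendsto α₀
  simp_rw [← he] at h0
  rw [sub_self, norm_zero, zero_pow two_ne_zero] at h0
  rw [ContinuousAt, tendsto_iff_norm_sub_tendsto_zero]
  have := h0.sqrt
  simpa [Real.sqrt_sq] using this

/-- Multiplication by a phase is isometric, so the error splits into that of the translation and
that of the phase on the fixed vector `t α₀`. Strong continuity is what later makes the channel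
integrand measurable. -/
theorem continuous_displacement_apply (f : ModeSpace n) :
    Continuous fun α : Phase n => displacement α f := by
  rw [continuous_iff_continuousAt]
  intro α₀
  set t : Phase n → ModeSpace n := fun α => translation (fun j => √2 * (α j).re) f
  have ht : Continuous t := (continuous_translation_apply f).comp (by fun_prop)
  have h1 : Filter.Tendsto (fun α => ‖t α - t α₀‖) (nhds α₀) (nhds 0) :=
    tendsto_iff_norm_sub_tendsto_zero.1 (ht.tendsto α₀)
  have h2 : Filter.Tendsto (fun α => ‖phaseMul α (t α₀) - phaseMul α₀ (t α₀)‖)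
      (nhds α₀) (nhds 0) :=
    tendsto_iff_norm_sub_tendsto_zero.1 ((continuous_phaseMul_apply (t α₀)).tendsto α₀)
  rw [ContinuousAt, tendsto_iff_norm_sub_tendsto_zero]
  have h3 := h1.add h2
  rw [add_zero] at h3
  refine squeeze_zero (fun _ => norm_nonneg _) (fun α => ?_) h3
  have e : displacement α f - displacement α₀ f =
      phaseMul α (t α - t α₀) + (phaseMul α (t α₀) - phaseMul α₀ (t α₀)) := by
    rw [map_sub]
    change phaseMul α (t α) - phaseMul α₀ (t α₀) = _
    abel
  rw [e]
  refine (norm_add_le _ _).trans ?_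
  rw [norm_phaseMul_apply]

end Displacement

/-! ### Matrix elements in the number basis -/

section MatrixElements

/-- The matrix element `⟨j|D(a)|k⟩` of the displacement operator of one mode. -/
def displacementElem (a : ℂ) (j k : ℕ) : ℂ :=
  ∫ x : ℝ, (hermiteFn j x : ℂ) *
    (Complex.exp (((√2 * a.im * x - a.re * a.im : ℝ) : ℂ) * Complex.I) *
      (hermiteFn k (x - √2 * a.re) : ℂ))

/-- Hermite functions are real, so conjugation only flips the phase. The second register, displaced
by `α*`, therefore contributes conjugate matrix elements, and products over both registers become
squared moduli. -/
theorem displacementElem_conj (a : ℂ) (j k : ℕ) :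
    displacementElem (starRingEnd ℂ a) j k = starRingEnd ℂ (displacementElem a j k) := by
  rw [displacementElem, displacementElem, ← integral_conj]
  refine integral_congr_ae (Filter.Eventually.of_forall fun x => ?_)
  simp only [map_mul, Complex.conj_ofReal, ← Complex.exp_conj, Complex.conj_I, Complex.conj_re,
    Complex.conj_im]
  congr 3
  push_cast
  ring

variable {n : ℕ}

theorem inner_numberState_displacement (α : Phase n) (j k : Fin n → ℕ) :
    ⟪numberState j, displacement α (numberState k)⟫_ℂ =
      ∏ i, displacementElem (α i) (j i) (k i) := by
  simp only [displacementElem]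
  rw [← integral_fintype_prod_volume_eq_prod, L2.inner_def]
  refine integral_congr_ae ?_
  have h := (measurePreserving_sub_right (volume : Measure (Fin n → ℝ))
    (fun j => √2 * (α j).re)).quasiMeasurePreserving.ae_eq_comp (memLp_numberFn k).coeFn_toLp
  filter_upwards [displacement_ae α (numberState k), (memLp_numberFn j).coeFn_toLp, h]
    with x h1 h2 h3
  simp only [Function.comp_apply] at h3
  rw [h1, numberState, numberState, h2, h3, RCLike.inner_apply, mul_comm]
  simp only [numberFn, map_prod, Complex.conj_ofReal, Finset.prod_mul_distrib, displacementPhase,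
    Pi.sub_apply]
  congr 2
  rw [← Complex.exp_sum, ← Finset.sum_mul, Complex.ofReal_sum]

theorem inner_numberState_displacement_star (α : Phase n) (j k : Fin n → ℕ) :
    ⟪numberState j, displacement (star α) (numberState k)⟫_ℂ =
      ∏ i, starRingEnd ℂ (displacementElem (α i) (j i) (k i)) := by
  rw [inner_numberState_displacement]
  exact Finset.prod_congr rfl fun i _ => displacementElem_conj _ _ _

theorem norm_numberState_sq (k : Fin n → ℕ) :
    ‖numberState k‖ ^ 2 = ∏ i, ∫ x, hermiteFn (k i) x ^ 2 := by
  rw [norm_sq_eq_integral, ← integral_fintype_prod_volume_eq_prod]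
  refine integral_congr_ae ?_
  filter_upwards [(memLp_numberFn k).coeFn_toLp] with x h
  rw [numberState, h]
  simp [numberFn, Finset.prod_pow, ← Finset.abs_prod]

end MatrixElements

end BosonicLearning

end

noncomputable section

/-! ### Existence of limits in Lévy's continuity theorem -/

/-- Continuity of the limit at 0 forces tightness, so the sequence is relatively compact. A limit
along an ultrafilter finer than `atTop` exists, and testing it against the bounded characters
identifies its characteristic function. -/
theorem MeasureTheory.ProbabilityMeasure.exists_charFun_eq_of_tendsto {E : Type*}
    [NormedAddCommGroup E] [InnerProductSpace ℝ E] [FiniteDimensional ℝ E] [MeasurableSpace E]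
    [BorelSpace E] {μ : ℕ → ProbabilityMeasure E} {f : E → ℂ} (hf : ContinuousAt f 0)
    (h : ∀ t, Filter.Tendsto (fun k => charFun (μ k : Measure E) t) Filter.atTop (nhds (f t))) :
    ∃ μ₀ : ProbabilityMeasure E, ∀ t, charFun (μ₀ : Measure E) t = f t := by
  have ht : IsTightMeasureSet (Set.range fun k => (μ k : Measure E)) :=
    isTightMeasureSet_of_tendsto_charFun hf h
  have hc : IsCompact (closure (Set.range μ)) := isCompact_closure_of_isTightMeasureSet (by
    convert ht using 1
    ext ν
    simp)
  obtain ⟨U, hU⟩ := Ultrafilter.exists_le (Filter.atTop : Filter ℕ)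
  obtain ⟨μ₀, -, h0⟩ := hc.ultrafilter_le_nhds (U.map μ)
    (Filter.le_principal_iff.2 (Filter.mem_map.2 (Filter.univ_mem' fun k =>
      subset_closure ⟨k, rfl⟩)))
  refine ⟨μ₀, fun t => ?_⟩
  have h1 : Filter.Tendsto μ U (nhds μ₀) := h0
  rw [ProbabilityMeasure.tendsto_iff_forall_integral_rclike_tendsto ℂ] at h1
  have h2 := h1 (BoundedContinuousFunction.innerProbChar t)
  simp_rw [← charFun_eq_integral_innerProbChar] at h2
  exact tendsto_nhds_unique h2 ((h t).mono_left hU)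

namespace BosonicLearning

/-! ### Fourier analysis on phase space; attainment of the classicality; Gaussian noise -/

section PhaseSpace

variable {n : ℕ}

theorem continuous_sympChar : Continuous fun p : Phase n × Phase n => sympChar p.1 p.2 := by
  unfold sympChar dotProduct
  fun_prop

theorem norm_sympChar (β α : Phase n) : ‖sympChar β α‖ = 1 := by
  rw [sympChar_eq_exp]
  exact Complex.norm_exp_ofReal_mul_I _

theorem sympChar_add (β γ α : Phase n) :
    sympChar (β + γ) α = sympChar β α * sympChar γ α := by
  simp only [sympChar]
  rw [← Complex.exp_add, star_add, add_dotProduct, dotProduct_add]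
  congr 1
  ring

theorem integrable_sympChar (μ : Measure (Phase n)) [IsFiniteMeasure μ] (α : Phase n) :
    Integrable (fun β => sympChar β α) μ := by
  have hc : Continuous fun β : Phase n => sympChar β α :=
    continuous_sympChar.comp (by fun_prop : Continuous fun β : Phase n => (β, α))
  exact (integrable_const (1 : ℝ)).mono hc.aestronglyMeasurable
    (Filter.Eventually.of_forall fun β => by simp [norm_sympChar])

theorem continuous_integral_sympChar (μ : Measure (Phase n)) [IsFiniteMeasure μ] :
    Continuous fun α => ∫ β, sympChar β α ∂μ := by
  refine continuous_of_dominated (bound := fun _ => 1)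
    (fun α => (integrable_sympChar μ α).aestronglyMeasurable)
    (fun α => Filter.Eventually.of_forall fun β => (norm_sympChar β α).le) (integrable_const _)
    (Filter.Eventually.of_forall fun β => ?_)
  exact continuous_sympChar.comp (by fun_prop : Continuous fun α : Phase n => (β, α))

theorem norm_integral_sympChar_le (μ : Measure (Phase n)) [IsProbabilityMeasure μ] (α : Phase n) :
    ‖∫ β, sympChar β α ∂μ‖ ≤ 1 := by
  refine (norm_integral_le_of_norm_le_const
    (Filter.Eventually.of_forall fun β => (norm_sympChar β α).le)).trans ?_
  simp

theorem integral_sympChar_conv (μ ν : Measure (Phase n)) [IsFiniteMeasure μ] [IsFiniteMeasure ν]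
    (α : Phase n) :
    ∫ β, sympChar β α ∂(μ.conv ν) = (∫ β, sympChar β α ∂μ) * ∫ β, sympChar β α ∂ν := by
  rw [integral_conv (integrable_sympChar _ α)]
  simp only [sympChar_add, integral_const_mul, integral_mul_const]

theorem continuous_normSqSum : Continuous (normSqSum : Phase n → ℝ) := by
  unfold normSqSum
  fun_prop

/-- The symplectic form `2(Re β Im α - Im β Re α)` is the real inner product of `β` with `-2iα`, so
the symplectic transform is the Euclidean one after an invertible change of frequency. -/
theorem charFun_map_toLp (μ : Measure (Phase n)) (α : Phase n) :
    charFun (μ.map (MeasurableEquiv.toLp 2 (Phase n))) (WithLp.toLp 2 ((-2 * Complex.I) • α)) =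
      ∫ β, sympChar β α ∂μ := by
  rw [charFun_apply, integral_map_equiv]
  refine integral_congr_ae (Filter.Eventually.of_forall fun β => ?_)
  simp only [sympChar_eq_exp]
  congr 3
  rw [PiLp.inner_apply]
  refine Finset.sum_congr rfl fun j _ => ?_
  simp [Complex.inner]
  ring

theorem exists_measure_of_tendsto_integral_sympChar {W : ℕ → Measure (Phase n)}
    (hW : ∀ k, IsProbabilityMeasure (W k)) {g : Phase n → ℂ} (hg : Continuous g)
    (h : ∀ α, Filter.Tendsto (fun k => ∫ β, sympChar β α ∂W k) Filter.atTop (nhds (g α))) :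
    ∃ W₀ : Measure (Phase n), IsProbabilityMeasure W₀ ∧ ∀ α, ∫ β, sympChar β α ∂W₀ = g α := by
  have hI : -2 * Complex.I ≠ 0 := by simp
  set e := MeasurableEquiv.toLp 2 (Phase n)
  obtain ⟨μ₀, h0⟩ := ProbabilityMeasure.exists_charFun_eq_of_tendsto
    (μ := fun k => ⟨(W k).map e, Measure.isProbabilityMeasure_map e.measurable.aemeasurable⟩)
    (f := fun t : EuclideanSpace ℂ (Fin n) => g ((-2 * Complex.I)⁻¹ • WithLp.ofLp t))
    (by
      have : Continuous fun t : EuclideanSpace ℂ (Fin n) =>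
        g ((-2 * Complex.I)⁻¹ • WithLp.ofLp t) := hg.comp (by fun_prop)
      exact this.continuousAt)
    (fun t => by
      have e1 : t = WithLp.toLp 2 ((-2 * Complex.I) • ((-2 * Complex.I)⁻¹ • WithLp.ofLp t)) := by
        rw [smul_inv_smul₀ hI]
      have := h ((-2 * Complex.I)⁻¹ • WithLp.ofLp t)
      simp_rw [← charFun_map_toLp, ← e1] at this
      exact this)
  refine ⟨(μ₀ : Measure _).map e.symm,
    Measure.isProbabilityMeasure_map e.symm.measurable.aemeasurable, fun α => ?_⟩
  rw [← charFun_map_toLp, MeasurableEquiv.map_map_symm, h0]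
  simp only [inv_smul_smul₀ hI]

/-- The supremum defining the classicality is attained. -/
theorem exists_isNonnegQPD_classicality {ρ : Op (ModeSpace n)} (hs : 0 < classicality ρ) :
    ∃ W, IsNonnegQPD ρ (classicality ρ) W := by
  set S := {s : ℝ | s ∈ Set.Icc (-1 : ℝ) 1 ∧ ∃ W : Measure (Phase n), IsNonnegQPD ρ s W} with hS
  have hne : S.Nonempty := by
    -- The supremum of the empty set is 0 by convention, which positivity excludes.
    by_contra hn
    rw [Set.not_nonempty_iff_eq_empty] at hn
    rw [classicality, ← hS, hn, Real.sSup_empty] at hs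
    exact hs.false
  have hb : BddAbove S := ⟨1, fun s hs => hs.1.2⟩
  obtain ⟨u, -, hu, hmem⟩ := exists_seq_tendsto_sSup hne hb
  choose W hW using fun k => (hmem k).2
  have hprob : ∀ k, IsProbabilityMeasure (W k) := fun k => (hW k).isProbability
  -- Continuity comes from the transform of `W 0` divided by its Gaussian factor, with no appeal to
  -- the trace.
  have hcont : Continuous (charFn ρ) := by
    have h1 : charFn ρ = fun α =>
        (Real.exp (-(u 0 * normSqSum α / 2)) : ℂ) * ∫ β, sympChar β α ∂W 0 := by
      ext α
      rw [(hW 0).fourier, orderedCharFn, ← mul_assoc, ← Complex.ofReal_mul, ← Real.exp_add]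
      simp
    rw [h1]
    have := continuous_normSqSum (n := n)
    have := continuous_integral_sympChar (W 0)
    fun_prop
  obtain ⟨W₀, h1, h2⟩ := exists_measure_of_tendsto_integral_sympChar hprob
    (g := orderedCharFn ρ (sSup S))
    (by
      have := continuous_normSqSum (n := n)
      unfold orderedCharFn
      fun_prop)
    (fun α => by
      simp_rw [(hW _).fourier, orderedCharFn]
      have hc : Continuous fun s : ℝ => (Real.exp (s * normSqSum α / 2) : ℂ) * charFn ρ α := by
        fun_prop
      exact (hc.tendsto _).comp hu)
  exact ⟨W₀, h1, h2⟩

theorem classicality_le_one {ρ : Op (ModeSpace n)} : classicality ρ ≤ 1 :=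
  Real.sSup_le (fun _ h => h.1.2) zero_le_one

instance isProbabilityMeasure_complexGaussian (c : ℝ≥0) :
    IsProbabilityMeasure (complexGaussian n c) := by
  have : IsProbabilityMeasure (((ProbabilityTheory.gaussianReal 0 (c / 2)).prod
      (ProbabilityTheory.gaussianReal 0 (c / 2))).map Complex.measurableEquivRealProd.symm) :=
    Measure.isProbabilityMeasure_map (MeasurableEquiv.measurable _).aemeasurable
  unfold complexGaussian
  infer_instance

/-- Variance `c/2` at frequency `2y` gives the exponent `-(c/2)(2y)²/2 = -c y²`. -/
theorem integral_exp_gaussianReal (c : ℝ≥0) (y : ℝ) :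
    ∫ x : ℝ, Complex.exp (((2 * y * x : ℝ) : ℂ) * Complex.I)
      ∂(ProbabilityTheory.gaussianReal 0 (c / 2)) = Complex.exp (((-(c * y ^ 2) : ℝ) : ℂ)) := by
  have h := ProbabilityTheory.charFun_gaussianReal (μ := 0) (v := c / 2) (2 * y)
  rw [charFun_apply_real] at h
  convert h using 2
  · ext x
    push_cast
    rfl
  · push_cast
    ring

theorem integral_sympChar_complexGaussian (c : ℝ≥0) (α : Phase n) :
    ∫ β, sympChar β α ∂(complexGaussian n c) = (Real.exp (-(c * normSqSum α)) : ℂ) := by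
  have h1 : ∀ β : Phase n, sympChar β α = ∏ j, Complex.exp
      (((2 * ((β j).re * (α j).im - (β j).im * (α j).re) : ℝ) : ℂ) * Complex.I) := fun β => by
    rw [sympChar_eq_exp, ← Complex.exp_sum, ← Finset.sum_mul, Complex.ofReal_sum]
  have h2 : ∀ a : ℂ, ∫ b : ℂ, Complex.exp
      (((2 * (b.re * a.im - b.im * a.re) : ℝ) : ℂ) * Complex.I)
      ∂(((ProbabilityTheory.gaussianReal 0 (c / 2)).prod
      (ProbabilityTheory.gaussianReal 0 (c / 2))).map Complex.measurableEquivRealProd.symm) =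
      (Real.exp (-(c * ‖a‖ ^ 2)) : ℂ) := fun a => by
    rw [integral_map_equiv]
    have e : ∀ p : ℝ × ℝ, Complex.exp
      (((2 * ((Complex.measurableEquivRealProd.symm p).re * a.im -
        (Complex.measurableEquivRealProd.symm p).im * a.re) : ℝ) : ℂ) * Complex.I) =
        Complex.exp (((2 * a.im * p.1 : ℝ) : ℂ) * Complex.I) *
        Complex.exp (((2 * (-a.re) * p.2 : ℝ) : ℂ) * Complex.I) := fun p => by
      rw [← Complex.exp_add, ← add_mul, ← Complex.ofReal_add]
      congr 3
      simp only [Complex.measurableEquivRealProd_symm_apply]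
      ring
    simp_rw [e]
    rw [integral_prod_mul (μ := ProbabilityTheory.gaussianReal 0 (c / 2))
      (ν := ProbabilityTheory.gaussianReal 0 (c / 2))
      (fun x : ℝ => Complex.exp (((2 * a.im * x : ℝ) : ℂ) * Complex.I))
      (fun x : ℝ => Complex.exp (((2 * (-a.re) * x : ℝ) : ℂ) * Complex.I)),
      integral_exp_gaussianReal, integral_exp_gaussianReal, ← Complex.exp_add,
      ← Complex.ofReal_add, Complex.ofReal_exp]
    congr 2
    rw [Complex.sq_norm, Complex.normSq_apply]
    ring
  simp_rw [h1, complexGaussian]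
  rw [integral_fintype_prod_eq_prod (fun j (b : ℂ) => Complex.exp
      (((2 * (b.re * (α j).im - b.im * (α j).re) : ℝ) : ℂ) * Complex.I))]
  simp_rw [h2]
  rw [← Complex.ofReal_prod, ← Real.exp_sum, normSqSum, Finset.mul_sum, Finset.sum_neg_distrib]

end PhaseSpace

/-! ### Bell densities with Gaussian smoothing -/

section BellDensity

variable {n : ℕ}

/-- The phase is `2i` times the real inner product of `iw` with `z`, so this is a Gaussian Fourier
integral on the real plane. -/
theorem integral_exp_mul_gaussian_mode {b : ℝ} (hb : 0 < b) (w : ℂ) :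
    ∫ z : ℂ, Complex.exp (((2 * (w.re * z.im - w.im * z.re) : ℝ) : ℂ) * Complex.I) *
      (Real.exp (-(b * ‖z‖ ^ 2)) : ℂ) = (((π / b) * Real.exp (-(‖w‖ ^ 2 / b)) : ℝ) : ℂ) := by
  have h := GaussianFourier.integral_cexp_neg_mul_sq_norm_add (V := ℂ) (b := (b : ℂ))
    (by simpa using hb) (2 * Complex.I) (Complex.I * w)
  have e : ∀ z : ℂ, Complex.exp (((2 * (w.re * z.im - w.im * z.re) : ℝ) : ℂ) * Complex.I) *
      (Real.exp (-(b * ‖z‖ ^ 2)) : ℂ) =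
      Complex.exp (-(b : ℂ) * ‖z‖ ^ 2 + 2 * Complex.I * (⟪Complex.I * w, z⟫_ℝ : ℝ)) := fun z => by
    rw [Complex.ofReal_exp, ← Complex.exp_add, Complex.inner]
    congr 1
    simp
    ring
  simp_rw [e]
  refine h.trans ?_
  rw [Complex.finrank_real_complex]
  have hb' : (b : ℂ) ≠ 0 := by exact_mod_cast hb.ne'
  have e1 : ((2 : ℕ) : ℂ) / 2 = 1 := by norm_num
  rw [e1, Complex.cpow_one, Complex.ofReal_mul, Complex.ofReal_exp, Complex.ofReal_div]
  congr 2
  rw [norm_mul, Complex.norm_I, one_mul, mul_pow, Complex.I_sq]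
  push_cast
  field_simp
  norm_num
  ring

theorem integrable_gaussian_mode {b : ℝ} (hb : 0 < b) :
    Integrable fun z : ℂ => Real.exp (-(b * ‖z‖ ^ 2)) := by
  have h := GaussianFourier.integrable_cexp_neg_mul_sq_norm_add (V := ℂ) (b := (b : ℂ))
    (by simpa using hb) 0 0
  refine h.norm.congr (Filter.Eventually.of_forall fun z => ?_)
  simp only [zero_mul, add_zero, Complex.norm_exp]
  congr 1
  rw [← Complex.ofReal_pow, ← Complex.ofReal_neg, ← Complex.ofReal_mul, Complex.ofReal_re]
  ring

theorem exp_normSqSum_eq_prod (b : ℝ) (α : Phase n) :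
    Real.exp (-(b * normSqSum α)) = ∏ j, Real.exp (-(b * ‖α j‖ ^ 2)) := by
  rw [normSqSum, ← Real.exp_sum, Finset.mul_sum, Finset.sum_neg_distrib]

theorem integrable_exp_normSqSum {b : ℝ} (hb : 0 < b) :
    Integrable fun α : Phase n => Real.exp (-(b * normSqSum α)) := by
  simp_rw [exp_normSqSum_eq_prod]
  exact Integrable.fintype_prod (f := fun _ (z : ℂ) => Real.exp (-(b * ‖z‖ ^ 2)))
    fun _ => integrable_gaussian_mode hb

theorem integral_sympChar_mul_gaussian {b : ℝ} (hb : 0 < b) (w : Phase n) :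
    ∫ α : Phase n, sympChar w α * (Real.exp (-(b * normSqSum α)) : ℂ) =
      (((π / b) ^ n * Real.exp (-(normSqSum w / b)) : ℝ) : ℂ) := by
  have e : ∀ α : Phase n, sympChar w α * (Real.exp (-(b * normSqSum α)) : ℂ) =
      ∏ j, (Complex.exp (((2 * ((w j).re * (α j).im - (w j).im * (α j).re) : ℝ) : ℂ) *
        Complex.I) * (Real.exp (-(b * ‖α j‖ ^ 2)) : ℂ)) := fun α => by
    rw [Finset.prod_mul_distrib, ← Complex.ofReal_prod, ← exp_normSqSum_eq_prod, sympChar_eq_exp,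
      ← Complex.exp_sum, ← Finset.sum_mul, Complex.ofReal_sum]
  simp_rw [e]
  rw [integral_fintype_prod_volume_eq_prod (fun j (z : ℂ) =>
    Complex.exp (((2 * ((w j).re * z.im - (w j).im * z.re) : ℝ) : ℂ) *
        Complex.I) * (Real.exp (-(b * ‖z‖ ^ 2)) : ℂ))]
  simp_rw [integral_exp_mul_gaussian_mode hb]
  rw [← Complex.ofReal_prod, Finset.prod_mul_distrib, Finset.prod_const, Finset.card_univ,
    Fintype.card_fin, ← Real.exp_sum, Finset.sum_neg_distrib, normSqSum, Finset.sum_div]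

/-- The density `(πs)^{-n} e^{-|w|²/s}`. -/
def gaussianDensity (s : ℝ) (w : Phase n) : ℝ :=
  ((π * s) ^ n)⁻¹ * Real.exp (-(s⁻¹ * normSqSum w))

theorem gaussianDensity_nonneg {s : ℝ} (hs : 0 < s) (w : Phase n) : 0 ≤ gaussianDensity s w := by
  unfold gaussianDensity
  positivity

theorem continuous_gaussianDensity (s : ℝ) :
    Continuous (gaussianDensity s : Phase n → ℝ) := by
  have := continuous_normSqSum (n := n)
  unfold gaussianDensity
  fun_prop

theorem integrable_gaussianDensity {s : ℝ} (hs : 0 < s) :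
    Integrable (gaussianDensity s : Phase n → ℝ) :=
  (integrable_exp_normSqSum (inv_pos.2 hs)).const_mul _

theorem normSqSum_star (w : Phase n) : normSqSum (star w) = normSqSum w := by
  simp [normSqSum]

theorem normSqSum_neg (w : Phase n) : normSqSum (-w) = normSqSum w := by
  simp [normSqSum]

theorem integral_sympChar_mul_gaussianDensity {s : ℝ} (hs : 0 < s) (w : Phase n) :
    ∫ α : Phase n, sympChar w α * (gaussianDensity s α : ℂ) =
      (Real.exp (-(s * normSqSum w)) : ℂ) := by
  have e : ∀ α : Phase n, sympChar w α * (gaussianDensity s α : ℂ) =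
      (((π * s) ^ n)⁻¹ : ℝ) * (sympChar w α * (Real.exp (-(s⁻¹ * normSqSum α)) : ℂ)) := fun α => by
    rw [gaussianDensity, Complex.ofReal_mul]
    ring
  simp_rw [e]
  rw [integral_const_mul, integral_sympChar_mul_gaussian (inv_pos.2 hs), ← Complex.ofReal_mul,
    ← mul_assoc, div_inv_eq_mul, div_inv_eq_mul, inv_mul_cancel₀ (by positivity), one_mul,
    mul_comm s]

theorem sympChar_zero (α : Phase n) : sympChar 0 α = 1 := by
  simp [sympChar]

theorem integral_gaussianDensity {s : ℝ} (hs : 0 < s) :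
    ∫ α : Phase n, gaussianDensity s α = 1 := by
  have h := integral_sympChar_mul_gaussianDensity hs (0 : Phase n)
  simp_rw [sympChar_zero, one_mul] at h
  rw [integral_complex_ofReal] at h
  have h2 : normSqSum (0 : Phase n) = 0 := by simp [normSqSum]
  rw [h2, mul_zero, neg_zero, Real.exp_zero] at h
  exact_mod_cast h

/-- The density of the reflection of `Q * 𝒩_s`. -/
def smoothedDensity (s : ℝ) (Q : Measure (Phase n)) (ζ : Phase n) : ℝ :=
  ∫ β, gaussianDensity s (ζ + star β) ∂Q

/-- Integrate in `ζ` first: by translation invariance each slice has mass 1, and `Q` is finite. All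
exchanges of `ζ` and `β` rest on this. -/
theorem integrable_prod_gaussianDensity {s : ℝ} (hs : 0 < s) (Q : Measure (Phase n))
    [IsProbabilityMeasure Q] :
    Integrable (fun p : Phase n × Phase n => gaussianDensity s (p.1 + star p.2))
      (volume.prod Q) := by
  have hc : Continuous fun p : Phase n × Phase n => gaussianDensity s (p.1 + star p.2) :=
    (continuous_gaussianDensity s).comp (by fun_prop)
  rw [integrable_prod_iff' hc.aestronglyMeasurable]
  have e : ∀ β : Phase n, ∫ ζ : Phase n, ‖gaussianDensity s (ζ + star β)‖ = 1 := fun β => by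
    rw [integral_add_right_eq_self (fun ζ : Phase n => ‖gaussianDensity s ζ‖) (star β)]
    simp_rw [Real.norm_of_nonneg (gaussianDensity_nonneg hs _)]
    exact integral_gaussianDensity hs
  simp only [e]
  refine ⟨Filter.Eventually.of_forall fun β => ?_, integrable_const _⟩
  exact (integrable_gaussianDensity hs).comp_add_right (star β)

theorem integral_smoothedDensity {s : ℝ} (hs : 0 < s) (Q : Measure (Phase n))
    [IsProbabilityMeasure Q] : ∫ ζ, smoothedDensity s Q ζ = 1 := by
  have h := integral_integral_swap (f := fun ζ β : Phase n => gaussianDensity s (ζ + star β))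
    (integrable_prod_gaussianDensity hs Q)
  refine h.trans ?_
  have e : ∀ β : Phase n, ∫ ζ : Phase n, gaussianDensity s (ζ + star β) = 1 := fun β => by
    rw [integral_add_right_eq_self (fun ζ : Phase n => gaussianDensity s ζ) (star β)]
    exact integral_gaussianDensity hs
  simp only [e]
  simp

set_option maxHeartbeats 1000000 in
theorem integrable_prod_sympChar_mul_exp {s : ℝ} (hs : 0 < s) (Q : Measure (Phase n))
    [IsProbabilityMeasure Q] (ζ : Phase n) :
    Integrable (fun p : Phase n × Phase n =>
      sympChar (ζ + p.2) p.1 * (Real.exp (-(s * normSqSum p.1)) : ℂ)) (volume.prod Q) := by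
  have h1 : Integrable (fun p : Phase n × Phase n => Real.exp (-(s * normSqSum p.1)))
      (volume.prod Q) := (integrable_exp_normSqSum hs).comp_fst Q
  have h2 : Continuous fun p : Phase n × Phase n => sympChar (ζ + p.2) p.1 :=
    continuous_sympChar.comp
      (by fun_prop : Continuous fun p : Phase n × Phase n => (ζ + p.2, p.1))
  have h3 : Continuous fun p : Phase n × Phase n => (Real.exp (-(s * normSqSum p.1)) : ℂ) := by
    have := continuous_normSqSum (n := n)
    fun_prop
  have h4 : AEStronglyMeasurable (fun p : Phase n × Phase n =>
      sympChar (ζ + p.2) p.1 * (Real.exp (-(s * normSqSum p.1)) : ℂ)) (volume.prod Q) :=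
    (h2.mul h3).aestronglyMeasurable
  have h5 : ∀ p : Phase n × Phase n, ‖sympChar (ζ + p.2) p.1 *
      (Real.exp (-(s * normSqSum p.1)) : ℂ)‖ ≤ Real.exp (-(s * normSqSum p.1)) := fun p => by
    rw [norm_mul, Complex.norm_real, norm_sympChar, one_mul,
      Real.norm_of_nonneg (Real.exp_nonneg _)]
  exact h1.mono' h4 (ae_of_all _ h5)

/-- Fubini, justified by the Gaussian damping in `α`, leaves the Gaussian integral at `star ζ + β`;
the constants match since `π^{-2n} (π/s)^n = (πs)^{-n}`. -/
theorem smoothedDensity_eq_integral {s : ℝ} (hs : 0 < s) (Q : Measure (Phase n))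
    [IsProbabilityMeasure Q] (ζ : Phase n) :
    (smoothedDensity s Q ζ : ℂ) = ((π : ℂ) ^ (2 * n))⁻¹ *
      ∫ α : Phase n, sympChar (star ζ) α *
        ((Real.exp (-(s * normSqSum α)) : ℂ) * ∫ β, sympChar β α ∂Q) := by
  have e : ∀ α : Phase n, sympChar (star ζ) α *
        ((Real.exp (-(s * normSqSum α)) : ℂ) * ∫ β, sympChar β α ∂Q) =
      ∫ β, sympChar (star ζ + β) α * (Real.exp (-(s * normSqSum α)) : ℂ) ∂Q := fun α => by
    simp_rw [sympChar_add]
    rw [integral_mul_const, integral_const_mul]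
    ring
  simp_rw [e]
  have h := integral_integral_swap (f := fun α β : Phase n =>
    sympChar (star ζ + β) α * (Real.exp (-(s * normSqSum α)) : ℂ))
    (integrable_prod_sympChar_mul_exp hs Q (star ζ))
  rw [h, smoothedDensity, ← integral_complex_ofReal, ← integral_const_mul]
  refine integral_congr_ae (Filter.Eventually.of_forall fun β => ?_)
  simp only
  rw [integral_sympChar_mul_gaussian hs, gaussianDensity, ← normSqSum_star, star_add, star_star]
  have hs' : (s : ℂ) ≠ 0 := by exact_mod_cast hs.ne'
  have hpi : (π : ℂ) ≠ 0 := by exact_mod_cast Real.pi_ne_zero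
  rw [div_eq_inv_mul (normSqSum (star ζ + β)), mul_pow, div_pow, two_mul, pow_add]
  push_cast
  field_simp

/-- Shifting `ζ` by `star β` extracts the phase `sympChar β α`; the remaining `ζ`-integral is the
transform of the Gaussian and no longer depends on `β`. -/
theorem integral_sympChar_mul_smoothedDensity {s : ℝ} (hs : 0 < s) (Q : Measure (Phase n))
    [IsProbabilityMeasure Q] (α : Phase n) :
    ∫ ζ : Phase n, sympChar (-star α) ζ * (smoothedDensity s Q ζ : ℂ) =
      (Real.exp (-(s * normSqSum α)) : ℂ) * ∫ β, sympChar β α ∂Q := by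
  have e : ∀ ζ : Phase n, sympChar (-star α) ζ * (smoothedDensity s Q ζ : ℂ) =
      ∫ β, sympChar β α * (sympChar (-star α) (ζ + star β) *
        (gaussianDensity s (ζ + star β) : ℂ)) ∂Q := fun ζ => by
    rw [smoothedDensity, ← integral_complex_ofReal, ← integral_const_mul]
    refine integral_congr_ae (Filter.Eventually.of_forall fun β => ?_)
    simp only [← mul_assoc]
    congr 1
    rw [sympChar, sympChar, sympChar, ← Complex.exp_add]
    congr 1
    simp only [star_neg, star_star, star_add, dotProduct_add, add_dotProduct, neg_dotProduct,
      dotProduct_neg]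
    rw [dotProduct_comm β (star α), dotProduct_comm (star β) α]
    ring
  simp_rw [e]
  have hi : Integrable (fun p : Phase n × Phase n =>
      sympChar p.2 α * (sympChar (-star α) (p.1 + star p.2) *
        (gaussianDensity s (p.1 + star p.2) : ℂ))) (volume.prod Q) := by
    have h1 : Continuous fun p : Phase n × Phase n => sympChar p.2 α :=
      continuous_sympChar.comp
        (by fun_prop : Continuous fun p : Phase n × Phase n => (p.2, α))
    have h2 : Continuous fun p : Phase n × Phase n => sympChar (-star α) (p.1 + star p.2) :=
      continuous_sympChar.comp
        (by fun_prop : Continuous fun p : Phase n × Phase n => (-star α, p.1 + star p.2))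
    have h3 : Continuous fun p : Phase n × Phase n =>
        (gaussianDensity s (p.1 + star p.2) : ℂ) :=
      Complex.continuous_ofReal.comp ((continuous_gaussianDensity s).comp (by fun_prop))
    have h4 : AEStronglyMeasurable (fun p : Phase n × Phase n =>
        sympChar p.2 α * (sympChar (-star α) (p.1 + star p.2) *
          (gaussianDensity s (p.1 + star p.2) : ℂ))) (volume.prod Q) :=
      (h1.mul (h2.mul h3)).aestronglyMeasurable
    have h5 : ∀ p : Phase n × Phase n, ‖sympChar p.2 α * (sympChar (-star α) (p.1 + star p.2) *
        (gaussianDensity s (p.1 + star p.2) : ℂ))‖ ≤ gaussianDensity s (p.1 + star p.2) :=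
      fun p => by
        rw [norm_mul, norm_mul, Complex.norm_real, norm_sympChar, norm_sympChar, one_mul, one_mul,
          Real.norm_of_nonneg (gaussianDensity_nonneg hs _)]
    exact (integrable_prod_gaussianDensity hs Q).mono' h4 (ae_of_all _ h5)
  have h := integral_integral_swap (f := fun ζ β : Phase n =>
    sympChar β α * (sympChar (-star α) (ζ + star β) * (gaussianDensity s (ζ + star β) : ℂ))) hi
  rw [h, mul_comm, ← integral_mul_const]
  refine integral_congr_ae (Filter.Eventually.of_forall fun β => ?_)
  simp only
  rw [integral_const_mul, integral_add_right_eq_self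
    (fun ζ : Phase n => sympChar (-star α) ζ * (gaussianDensity s ζ : ℂ)) (star β),
    integral_sympChar_mul_gaussianDensity hs, normSqSum_neg, normSqSum_star]

/-- A state whose Bell slice is `e^{-s|α|²}` times the characteristic function of a probability
measure has a Bell outcome density. -/
theorem isBellDensity_smoothedDensity {τ : Op (PairSpace n)} {s : ℝ} (hs : 0 < s)
    {Q : Measure (Phase n)} [IsProbabilityMeasure Q]
    (h : ∀ α, bellSlice τ α = (Real.exp (-(s * normSqSum α)) : ℂ) * ∫ β, sympChar β α ∂Q) :
    IsBellDensity τ (smoothedDensity s Q) where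
  integrable_slice := by
    have e : bellSlice τ =
      fun α => (Real.exp (-(s * normSqSum α)) : ℂ) * ∫ β, sympChar β α ∂Q := funext h
    rw [e]
    have h1 := continuous_normSqSum (n := n)
    have h2 := continuous_integral_sympChar Q
    refine (integrable_exp_normSqSum (n := n) hs).mono
      (Continuous.aestronglyMeasurable (by fun_prop)) (Filter.Eventually.of_forall fun α => ?_)
    rw [norm_mul, Complex.norm_real]
    exact mul_le_of_le_one_right (norm_nonneg _) (norm_integral_sympChar_le Q α)
  density_eq ζ := by
    rw [smoothedDensity_eq_integral hs]
    congr 1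
    refine integral_congr_ae (Filter.Eventually.of_forall fun α => ?_)
    simp only
    rw [h, sympChar, star_star, dotProduct_comm (star ζ)]
  nonneg ζ := integral_nonneg fun β => gaussianDensity_nonneg hs _
  integrable := (integrable_prod_gaussianDensity hs Q).integral_prod_left
  integral_eq_one := integral_smoothedDensity hs Q
  spectral α := by
    rw [h, ← integral_sympChar_mul_smoothedDensity hs]
    refine integral_congr_ae (Filter.Eventually.of_forall fun ζ => ?_)
    simp only
    congr 1
    rw [sympChar, star_neg, star_star, neg_dotProduct, dotProduct_neg, dotProduct_comm α]
    congr 1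
    ring

end BellDensity

/-! ### Mehler's formula -/

section Mehler

theorem integral_cexp_quadratic_ofReal {A : ℝ} (hA : 0 < A) (B C : ℂ) :
    ∫ x : ℝ, Complex.exp (-(A : ℂ) * x ^ 2 + B * x + C) =
      (√(π / A) : ℂ) * Complex.exp (C + B ^ 2 / (4 * A)) := by
  rw [integral_cexp_quadratic (by simpa using hA), neg_neg]
  congr 1
  · rw [← Complex.ofReal_div, Real.sqrt_eq_rpow,
      Complex.ofReal_cpow (div_nonneg Real.pi_pos.le hA.le)]
    norm_num
  · congr 1
    rw [mul_neg, div_neg, sub_neg_eq_add]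

/-- Combined with the defining relation `He_{k+1} = X He_k - He_k'`, this gives the three-term
recurrence that the Gaussian moments are shown to satisfy. -/
theorem derivative_hermite_succ (k : ℕ) :
    Polynomial.derivative (Polynomial.hermite (k + 1)) =
      ((k + 1 : ℕ) : Polynomial ℤ) * Polynomial.hermite k := by
  induction k with
  | zero => simp
  | succ k ih =>
    have h1 : Polynomial.derivative (Polynomial.hermite k) =
        Polynomial.X * Polynomial.hermite k - Polynomial.hermite (k + 1) := by
      rw [Polynomial.hermite_succ k]
      ring
    rw [Polynomial.hermite_succ (k + 1), Polynomial.derivative_sub, ih, Polynomial.derivative_mul,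
      Polynomial.derivative_mul, Polynomial.derivative_natCast, ih, h1, Polynomial.derivative_X]
    push_cast
    ring

theorem aeval_hermite_succ_succ (k : ℕ) (u : ℝ) :
    (Polynomial.aeval u (Polynomial.hermite (k + 2)) : ℝ) =
      u * Polynomial.aeval u (Polynomial.hermite (k + 1)) -
        (k + 1) * Polynomial.aeval u (Polynomial.hermite k) := by
  rw [Polynomial.hermite_succ (k + 1), derivative_hermite_succ]
  simp

theorem norm_add_I_mul_sq (u z : ℝ) : ‖(u + Complex.I * (√2 * z : ℝ) : ℂ)‖ ^ 2 = u ^ 2 + 2 * z ^ 2 := by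
  rw [Complex.sq_norm, Complex.normSq_apply]
  simp
  ring_nf
  norm_num
  ring

theorem integrable_pow_mul_gaussian (u : ℝ) (k : ℕ) :
    Integrable fun z : ℝ => (u + Complex.I * (√2 * z : ℝ) : ℂ) ^ k * (Real.exp (-(z ^ 2)) : ℂ) := by
  have h := integrable_poly_mul_gaussian
    ((Polynomial.C (1 + u ^ 2) + Polynomial.C 2 * Polynomial.X ^ 2) ^ k)
  refine h.mono (Continuous.aestronglyMeasurable (by fun_prop))
    (Filter.Eventually.of_forall fun z => ?_)
  rw [norm_mul, norm_mul, Complex.norm_real, norm_pow]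
  refine mul_le_mul_of_nonneg_right ?_ (norm_nonneg _)
  have h1 := norm_add_I_mul_sq u z
  have h2 : ‖(u + Complex.I * (√2 * z : ℝ) : ℂ)‖ ≤ 1 + u ^ 2 + 2 * z ^ 2 := by
    nlinarith [sq_nonneg (‖(u + Complex.I * (√2 * z : ℝ) : ℂ)‖ - 1), sq_nonneg u, sq_nonneg z]
  simp only [Polynomial.eval_pow, Polynomial.eval_add, Polynomial.eval_C, Polynomial.eval_mul,
    Polynomial.eval_X]
  rw [Real.norm_of_nonneg (by positivity)]
  exact pow_le_pow_left₀ (norm_nonneg _) h2 k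

/-- `Heₖ(u) = E (u + iZ)^k` for a standard Gaussian `Z`. -/
theorem integral_pow_mul_gaussian (k : ℕ) (u : ℝ) :
    ∫ z : ℝ, (u + Complex.I * (√2 * z : ℝ) : ℂ) ^ k * (Real.exp (-(z ^ 2)) : ℂ) =
      ((√π * Polynomial.aeval u (Polynomial.hermite k) : ℝ) : ℂ) := by
  have h22 : √2 * √2 = 2 := Real.mul_self_sqrt (by norm_num)
  have hexp : ∫ z : ℝ, (Real.exp (-(z ^ 2)) : ℂ) = (√π : ℂ) := by
    rw [integral_complex_ofReal]
    have := integral_gaussian 1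
    simp only [neg_mul, one_mul, div_one] at this
    rw [this]
  have hz : ∫ z : ℝ, (z : ℂ) * (Real.exp (-(z ^ 2)) : ℂ) = 0 := by
    have h := integral_neg_eq_self (fun z : ℝ => (z : ℂ) * (Real.exp (-(z ^ 2)) : ℂ)) volume
    have e : ∀ z : ℝ, ((-z : ℝ) : ℂ) * (Real.exp (-((-z) ^ 2)) : ℂ) =
        -((z : ℂ) * (Real.exp (-(z ^ 2)) : ℂ)) := fun z => by
      rw [neg_sq]
      push_cast
      ring
    simp_rw [e, integral_neg] at h
    exact self_eq_neg.1 h.symm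
  induction k using Nat.twoStepInduction with
  | zero => simpa using hexp
  | one =>
    have e : ∀ z : ℝ, (u + Complex.I * (√2 * z : ℝ) : ℂ) ^ 1 * (Real.exp (-(z ^ 2)) : ℂ) =
        (u : ℂ) * (Real.exp (-(z ^ 2)) : ℂ) +
          (Complex.I * √2) * ((z : ℂ) * (Real.exp (-(z ^ 2)) : ℂ)) := fun z => by
      push_cast
      ring
    have h0 := integrable_pow_mul_gaussian 0 1
    have h1 : Integrable fun z : ℝ => (u : ℂ) * (Real.exp (-(z ^ 2)) : ℂ) := by
      simpa using (integrable_pow_mul_gaussian u 0).const_mul (u : ℂ)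
    have h2 : Integrable fun z : ℝ =>
        (Complex.I * √2) * ((z : ℂ) * (Real.exp (-(z ^ 2)) : ℂ)) := by
      refine h0.congr (Filter.Eventually.of_forall fun z => ?_)
      simp
      ring
    simp_rw [e]
    rw [integral_add h1 h2, integral_const_mul, integral_const_mul, hexp, hz]
    simp
    ring
  | more k ih1 ih2 =>
    set w : ℝ → ℂ := fun z => (u + Complex.I * (√2 * z : ℝ) : ℂ) with hw
    set g : ℝ → ℂ := fun z => (Real.exp (-(z ^ 2)) : ℂ) with hg
    have hI : ∀ m, Integrable fun z => w z ^ m * g z := integrable_pow_mul_gaussian u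
    have hwd : ∀ z, HasDerivAt w (Complex.I * √2) z := fun z => by
      have h1 : HasDerivAt (fun z : ℝ => ((√2 * z : ℝ) : ℂ)) (√2 : ℂ) z := by
        have := ((hasDerivAt_id z).const_mul √2).ofReal_comp
        simpa using this
      exact (h1.const_mul Complex.I).const_add _
    have hgd : ∀ z, HasDerivAt g (-(2 * z) * g z) z := fun z => by
      have h1 : HasDerivAt (fun z : ℝ => Real.exp (-(z ^ 2)))
          (Real.exp (-(z ^ 2)) * (-(2 * z))) z := by
        have := ((hasDerivAt_pow 2 z).neg).exp
        simpa using this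
      have := h1.ofReal_comp
      convert this using 1
      simp [hg]
      ring
    -- The integral of this derivative vanishes; rewriting `i√2 z` as `w - u` turns that into the
    -- Hermite recurrence for the moments.
    have hd : ∀ z, HasDerivAt (fun z => (Complex.I * (√2 : ℂ)) * (w z ^ (k + 1) * g z))
        (-(2 * ((k + 1 : ℕ) : ℂ)) * (w z ^ k * g z) +
          (-2) * (w z ^ (k + 2) * g z) + (2 * (u : ℂ)) * (w z ^ (k + 1) * g z)) z := fun z => by
      have h1 := ((((hwd z).pow (k + 1)).mul (hgd z)).const_mul (Complex.I * (√2 : ℂ)))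
      refine h1.congr_deriv ?_
      have hs : (√2 : ℂ) * √2 = 2 := by exact_mod_cast h22
      have hwz : Complex.I * (√2 : ℂ) * z = w z - u := by
        simp only [hw]
        push_cast
        ring
      change Complex.I * (√2 : ℂ) * (((k + 1 : ℕ) : ℂ) * w z ^ k * (Complex.I * √2) * g z +
        w z ^ (k + 1) * (-(2 * z) * g z)) = _
      linear_combination (((k + 1 : ℕ) : ℂ) * w z ^ k * g z) *
        (Complex.I ^ 2 * hs + 2 * Complex.I_sq) - 2 * w z ^ (k + 1) * g z * hwz
    have H1 : Integrable fun z => -(2 * ((k + 1 : ℕ) : ℂ)) * (w z ^ k * g z) := (hI k).const_mul _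
    have H2 : Integrable fun z => (-2) * (w z ^ (k + 2) * g z) := (hI (k + 2)).const_mul _
    have H3 : Integrable fun z => (2 * (u : ℂ)) * (w z ^ (k + 1) * g z) :=
      (hI (k + 1)).const_mul _
    have H12 : Integrable fun z => -(2 * ((k + 1 : ℕ) : ℂ)) * (w z ^ k * g z) +
      (-2) * (w z ^ (k + 2) * g z) := H1.add H2
    have h0 := integral_eq_zero_of_hasDerivAt_of_integrable hd (H12.add H3)
      ((hI (k + 1)).const_mul _)
    rw [integral_add H12 H3, integral_add H1 H2, integral_const_mul, integral_const_mul,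
      integral_const_mul, ih1, ih2] at h0
    change ∫ z, w z ^ (k + 2) * g z = _
    rw [aeval_hermite_succ_succ]
    push_cast at h0 ⊢
    linear_combination (-1 / 2 : ℂ) * h0

theorem integrable_exp_neg_sq_prod {b : ℝ} (hb : 0 < b) :
    Integrable fun p : ℝ × ℝ => Real.exp (-(b * p.1 ^ 2)) * Real.exp (-(b * p.2 ^ 2)) := by
  have h : Integrable fun x : ℝ => Real.exp (-(b * x ^ 2)) := by
    simpa using integrable_exp_neg_mul_sq hb
  exact h.mul_prod h

theorem hasSum_complex_exp (z : ℂ) :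
    HasSum (fun k : ℕ => z ^ k / (k.factorial : ℂ)) (Complex.exp z) := by
  rw [Complex.exp_eq_exp_ℂ]
  exact NormedSpace.expSeries_div_hasSum_exp z

theorem hasSum_real_exp (z : ℝ) :
    HasSum (fun k : ℕ => z ^ k / (k.factorial : ℝ)) (Real.exp z) := by
  rw [Real.exp_eq_exp_ℝ]
  exact NormedSpace.expSeries_div_hasSum_exp z

/-- By `ab ≤ (a² + b²)/2` the exponential costs at most `t p.1² + t p.2²` plus a constant in the
exponent, leaving Gaussian decay at rate `1 - t > 0`. -/
theorem integrable_mehler {t : ℝ} (ht0 : 0 ≤ t) (ht1 : t < 1) (u v : ℝ) :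
    Integrable fun p : ℝ × ℝ => Real.exp (t * ‖(u + Complex.I * (√2 * p.1 : ℝ) : ℂ)‖ *
      ‖(v + Complex.I * (√2 * p.2 : ℝ) : ℂ)‖) *
        (Real.exp (-(p.1 ^ 2)) * Real.exp (-(p.2 ^ 2))) := by
  have h := (integrable_exp_neg_sq_prod (sub_pos.2 ht1)).const_mul
    (Real.exp (t * (u ^ 2 + v ^ 2) / 2))
  refine h.mono (Continuous.aestronglyMeasurable (by fun_prop))
    (Filter.Eventually.of_forall fun p => ?_)
  rw [Real.norm_of_nonneg (by positivity), Real.norm_of_nonneg (by positivity), ← Real.exp_add,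
    ← Real.exp_add, ← Real.exp_add, ← Real.exp_add, Real.exp_le_exp]
  have h1 := norm_add_I_mul_sq u p.1
  have h2 := norm_add_I_mul_sq v p.2
  set a := ‖(u + Complex.I * (√2 * p.1 : ℝ) : ℂ)‖
  set b := ‖(v + Complex.I * (√2 * p.2 : ℝ) : ℂ)‖
  have h3 : t * (a * b) ≤ t * ((a ^ 2 + b ^ 2) / 2) :=
    mul_le_mul_of_nonneg_left (by nlinarith [sq_nonneg (a - b)]) ht0
  rw [h1, h2] at h3
  nlinarith

theorem integral_mehler {t : ℝ} (ht0 : 0 ≤ t) (ht1 : t < 1) (u v : ℝ) :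
    ∫ p : ℝ × ℝ, Complex.exp (t * (u + Complex.I * (√2 * p.1 : ℝ)) *
      (v + Complex.I * (√2 * p.2 : ℝ))) *
        ((Real.exp (-(p.1 ^ 2)) : ℂ) * (Real.exp (-(p.2 ^ 2)) : ℂ)) =
      ((π * ((√(1 - t ^ 2))⁻¹ *
        Real.exp ((2 * t * u * v - t ^ 2 * (u ^ 2 + v ^ 2)) / (2 * (1 - t ^ 2)))) : ℝ) : ℂ) := by
  have hpos : 0 < 1 - t ^ 2 := by nlinarith
  have hs : (√2 : ℂ) ^ 2 = 2 := by exact_mod_cast Real.sq_sqrt (by norm_num : (0 : ℝ) ≤ 2)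
  have hI : Integrable fun p : ℝ × ℝ => Complex.exp (t * (u + Complex.I * (√2 * p.1 : ℝ)) *
      (v + Complex.I * (√2 * p.2 : ℝ))) *
        ((Real.exp (-(p.1 ^ 2)) : ℂ) * (Real.exp (-(p.2 ^ 2)) : ℂ)) := by
    refine (integrable_mehler ht0 ht1 u v).mono' (Continuous.aestronglyMeasurable (by fun_prop))
      (Filter.Eventually.of_forall fun p => ?_)
    rw [norm_mul, norm_mul, Complex.norm_real, Complex.norm_real, Real.norm_of_nonneg
      (Real.exp_nonneg _), Real.norm_of_nonneg (Real.exp_nonneg _)]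
    refine mul_le_mul_of_nonneg_right ((Complex.norm_exp_le_exp_norm _).trans ?_) (by positivity)
    rw [norm_mul, norm_mul, Complex.norm_real, Real.norm_of_nonneg ht0]
  rw [Measure.volume_eq_prod, integral_prod _ hI]
  have e1 : ∀ x : ℝ, ∫ y : ℝ, Complex.exp (t * (u + Complex.I * (√2 * x : ℝ)) *
      (v + Complex.I * (√2 * y : ℝ))) * ((Real.exp (-(x ^ 2)) : ℂ) * (Real.exp (-(y ^ 2)) : ℂ)) =
      (√π : ℂ) * Complex.exp (-((1 - t ^ 2 : ℝ) : ℂ) * x ^ 2 +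
        (Complex.I * √2 * t * (v - t * u)) * x + (t * u * v - t ^ 2 * u ^ 2 / 2)) := fun x => by
    have h := integral_cexp_quadratic_ofReal one_pos (Complex.I * √2 * t * (u + Complex.I * √2 * x))
      (t * (u + Complex.I * √2 * x) * v - x ^ 2)
    rw [div_one] at h
    convert h using 2
    · ext y
      rw [Complex.ofReal_exp, Complex.ofReal_exp, ← Complex.exp_add, ← Complex.exp_add]
      congr 1
      push_cast
      ring
    · congr 1
      push_cast
      linear_combination (-(t ^ 2 * u ^ 2 : ℂ) / 4 * Complex.I ^ 2
        - t ^ 2 * u * Complex.I ^ 3 * √2 * x / 2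
        - t ^ 2 * Complex.I ^ 4 * x ^ 2 * (√2 ^ 2 + 2) / 4) * hs +
        (-(t ^ 2 * u ^ 2 : ℂ) / 2 - t ^ 2 * u * Complex.I * √2 * x
        - t ^ 2 * x ^ 2 * (Complex.I ^ 2 - 1)) * Complex.I_sq
  simp_rw [e1]
  rw [integral_const_mul, integral_cexp_quadratic_ofReal hpos, ← mul_assoc, ← Complex.ofReal_mul,
    Real.sqrt_div Real.pi_pos.le, ← mul_div_assoc, Real.mul_self_sqrt Real.pi_pos.le,
    Complex.ofReal_mul, Complex.ofReal_mul, Complex.ofReal_exp, ← mul_assoc, ← Complex.ofReal_mul,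
    div_eq_mul_inv]
  congr 1
  · push_cast
    rfl
  congr 1
  have hp : ((1 - t ^ 2 : ℝ) : ℂ) ≠ 0 := by exact_mod_cast hpos.ne'
  push_cast at hp ⊢
  have e2 : (Complex.I * √2 * t * (v - t * u) : ℂ) ^ 2 = -2 * (t * (v - t * u)) ^ 2 := by
    linear_combination ((t * (v - t * u)) ^ 2 : ℂ) * (Complex.I ^ 2 * hs + 2 * Complex.I_sq)
  rw [e2]
  field_simp
  ring

/-- **Mehler's formula** for the probabilists' Hermite polynomials. -/
theorem hasSum_hermite_mul_hermite {t : ℝ} (ht0 : 0 ≤ t) (ht1 : t < 1) (u v : ℝ) :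
    HasSum (fun k : ℕ => t ^ k / (k.factorial : ℝ) *
      ((Polynomial.aeval u (Polynomial.hermite k) : ℝ) *
        (Polynomial.aeval v (Polynomial.hermite k) : ℝ)))
      ((√(1 - t ^ 2))⁻¹ *
        Real.exp ((2 * t * u * v - t ^ 2 * (u ^ 2 + v ^ 2)) / (2 * (1 - t ^ 2)))) := by
  set w : ℝ → ℝ → ℂ := fun u z => (u + Complex.I * (√2 * z : ℝ) : ℂ) with hw
  set g : ℝ → ℝ := fun z => Real.exp (-(z ^ 2)) with hg
  have hg0 : ∀ z, 0 ≤ g z := fun z => Real.exp_nonneg _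
  -- With each Hermite polynomial written as a Gaussian moment, the series is the exponential series
  -- of `t w(u) w(v)` under a double integral, and dominated convergence sums it inside.
  set F : ℕ → ℝ × ℝ → ℂ := fun k p => ((t ^ k / (k.factorial : ℝ) : ℝ) : ℂ) *
    ((w u p.1 ^ k * (g p.1 : ℂ)) * (w v p.2 ^ k * (g p.2 : ℂ))) with hF
  set bound : ℕ → ℝ × ℝ → ℝ := fun k p =>
    (t * ‖w u p.1‖ * ‖w v p.2‖) ^ k / (k.factorial : ℝ) * (g p.1 * g p.2) with hbound
  have hb : ∀ p, HasSum (fun k => bound k p)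
      (Real.exp (t * ‖w u p.1‖ * ‖w v p.2‖) * (g p.1 * g p.2)) := fun p =>
    (hasSum_real_exp _).mul_right _
  have h := hasSum_integral_of_dominated_convergence (μ := (volume : Measure (ℝ × ℝ))) (F := F)
    (f := fun p => Complex.exp (t * w u p.1 * w v p.2) * ((g p.1 : ℂ) * (g p.2 : ℂ))) bound
    (fun k => by
      have : Continuous (F k) := by
        simp only [hF, hw, hg]
        fun_prop
      exact this.aestronglyMeasurable)
    (fun k => Filter.Eventually.of_forall fun p => by
      simp only [hF, hbound]
      rw [norm_mul, norm_mul, norm_mul, norm_mul, Complex.norm_real, Complex.norm_real,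
        Complex.norm_real, norm_pow, norm_pow, Real.norm_of_nonneg (hg0 _),
        Real.norm_of_nonneg (hg0 _), Real.norm_of_nonneg (by positivity)]
      apply le_of_eq
      ring)
    (Filter.Eventually.of_forall fun p => (hb p).summable)
    (by
      simp_rw [fun p => (hb p).tsum_eq]
      exact integrable_mehler ht0 ht1 u v)
    (Filter.Eventually.of_forall fun p => by
      have h1 := (hasSum_complex_exp (t * w u p.1 * w v p.2)).mul_right
        ((g p.1 : ℂ) * (g p.2 : ℂ))
      have e : (fun k => F k p) = fun k => (t * w u p.1 * w v p.2) ^ k / (k.factorial : ℂ) *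
          ((g p.1 : ℂ) * (g p.2 : ℂ)) := by
        funext k
        simp only [hF]
        rw [mul_pow, mul_pow]
        push_cast
        ring
      rw [e]
      exact h1)
  have e : ∀ k, ∫ p, F k p = ((π * (t ^ k / (k.factorial : ℝ) *
      ((Polynomial.aeval u (Polynomial.hermite k) : ℝ) *
        (Polynomial.aeval v (Polynomial.hermite k) : ℝ))) : ℝ) : ℂ) := fun k => by
    simp only [hF]
    rw [integral_const_mul, Measure.volume_eq_prod, integral_prod_mul
      (fun z : ℝ => w u z ^ k * (g z : ℂ)) (fun z : ℝ => w v z ^ k * (g z : ℂ)),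
      integral_pow_mul_gaussian, integral_pow_mul_gaussian, ← Complex.ofReal_mul,
      ← Complex.ofReal_mul]
    congr 1
    linear_combination (t ^ k / (k.factorial : ℝ) *
      ((Polynomial.aeval u (Polynomial.hermite k) : ℝ) *
        (Polynomial.aeval v (Polynomial.hermite k) : ℝ))) * Real.mul_self_sqrt Real.pi_pos.le
  simp_rw [e] at h
  rw [integral_mehler ht0 ht1] at h
  have h' := Complex.hasSum_ofReal.1 h
  exact (hasSum_mul_left_iff Real.pi_ne_zero).1 h'

/-- The Mehler kernel `∑ₖ tᵏ hₖ(x) hₖ(y)` of the Hermite functions. -/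
def mehlerKernel (t x y : ℝ) : ℝ :=
  (√(π * (1 - t ^ 2)))⁻¹ *
    Real.exp (-((1 - t) / (1 + t) * (x + y) ^ 2 / 4) - (1 + t) / (1 - t) * (x - y) ^ 2 / 4)

/-- Mehler's formula at `√2 x`, `√2 y`, times the two Gaussian factors. The exponent is diagonal in
`x + y` and `x - y`, with coefficients inverse to each other up to the common 1/4. -/
theorem hasSum_hermiteFn_mul_hermiteFn {t : ℝ} (ht0 : 0 ≤ t) (ht1 : t < 1) (x y : ℝ) :
    HasSum (fun k : ℕ => t ^ k * (hermiteFn k x * hermiteFn k y)) (mehlerKernel t x y) := by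
  have h := (hasSum_hermite_mul_hermite ht0 ht1 (√2 * x) (√2 * y)).mul_left
    ((√π)⁻¹ * (Real.exp (-(x ^ 2) / 2) * Real.exp (-(y ^ 2) / 2)))
  have h2 : √2 ^ 2 = 2 := Real.sq_sqrt (by norm_num)
  have h3 : (1 - t) ≠ 0 := by linarith
  have h4 : (1 + t) ≠ 0 := by linarith
  have e1 : ∀ k : ℕ, (√π)⁻¹ * (Real.exp (-(x ^ 2) / 2) * Real.exp (-(y ^ 2) / 2)) *
      (t ^ k / (k.factorial : ℝ) *
      ((Polynomial.aeval (√2 * x) (Polynomial.hermite k) : ℝ) *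
        (Polynomial.aeval (√2 * y) (Polynomial.hermite k) : ℝ))) =
      t ^ k * (hermiteFn k x * hermiteFn k y) := fun k => by
    have hk : (0 : ℝ) < k.factorial := by exact_mod_cast k.factorial_pos
    have e : (√((k.factorial : ℝ) * √π))⁻¹ ^ 2 = (√π)⁻¹ * (k.factorial : ℝ)⁻¹ := by
      rw [inv_pow, Real.sq_sqrt (by positivity), mul_inv, mul_comm]
    unfold hermiteFn
    linear_combination -(t ^ k * ((Polynomial.aeval (√2 * x) (Polynomial.hermite k) : ℝ) *
      Real.exp (-(x ^ 2) / 2)) * ((Polynomial.aeval (√2 * y) (Polynomial.hermite k) : ℝ) *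
      Real.exp (-(y ^ 2) / 2))) * e
  have e2 : (√π)⁻¹ * (Real.exp (-(x ^ 2) / 2) * Real.exp (-(y ^ 2) / 2)) * ((√(1 - t ^ 2))⁻¹ *
      Real.exp ((2 * t * (√2 * x) * (√2 * y) - t ^ 2 * ((√2 * x) ^ 2 + (√2 * y) ^ 2)) /
        (2 * (1 - t ^ 2)))) = mehlerKernel t x y := by
    unfold mehlerKernel
    rw [Real.sqrt_mul Real.pi_pos.le, mul_inv, mul_mul_mul_comm, ← Real.exp_add, ← Real.exp_add]
    congr 2
    rw [mul_pow, mul_pow, h2, show 2 * t * (√2 * x) * (√2 * y) = √2 ^ 2 * (2 * t * x * y) by ring,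
      h2, show 1 - t ^ 2 = (1 - t) * (1 + t) by ring]
    field_simp
    ring
  simp_rw [e1] at h
  rwa [e2] at h

theorem integral_hermiteFn_sq_nonneg (k : ℕ) : 0 ≤ ∫ x, hermiteFn k x ^ 2 :=
  integral_nonneg fun _ => sq_nonneg _

/-- The integral of the Mehler kernel over the diagonal bounds the partial sums. This gives all the
convergence needed, without computing the norms of the Hermite functions. -/
theorem summable_pow_mul_integral_hermiteFn_sq {t : ℝ} (ht0 : 0 ≤ t) (ht1 : t < 1) :
    Summable fun k : ℕ => t ^ k * ∫ x, hermiteFn k x ^ 2 := by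
  have hI : Integrable fun x => mehlerKernel t x x := by
    have hq : 0 < (1 - t) / (1 + t) := div_pos (by linarith) (by linarith)
    refine ((integrable_exp_neg_mul_sq hq).const_mul (√(π * (1 - t ^ 2)))⁻¹).congr
      (Filter.Eventually.of_forall fun x => ?_)
    simp only [mehlerKernel]
    congr 2
    ring
  refine summable_of_sum_le (c := ∫ x, mehlerKernel t x x)
    (fun k => mul_nonneg (pow_nonneg ht0 k) (integral_hermiteFn_sq_nonneg k)) fun s => ?_
  simp_rw [← integral_const_mul]
  rw [← integral_finsetSum _ fun k _ => (integrable_hermiteFn_sq k).const_mul _]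
  refine integral_mono (integrable_finsetSum _ fun k _ => (integrable_hermiteFn_sq k).const_mul _)
    hI fun x => ?_
  have h := hasSum_hermiteFn_mul_hermiteFn ht0 ht1 x x
  simp_rw [← sq] at h
  exact sum_le_hasSum s (fun k _ => mul_nonneg (pow_nonneg ht0 k) (sq_nonneg _)) h

/-- As `q ≤ 1 ≤ q⁻¹`, the terms in `x + y` and `x - y` together dominate `q (x² + y²)/2`; the
displaced term only helps. -/
theorem integrable_mehlerKernel_exponent {q : ℝ} (hq0 : 0 < q) (hq1 : q ≤ 1) (A b : ℝ) :
    Integrable fun p : ℝ × ℝ => Complex.exp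
      ((-(q * (p.1 + p.2) ^ 2 / 4) - q⁻¹ * (p.1 - p.2) ^ 2 / 4 -
        q * ((p.1 - A) + (p.2 - A)) ^ 2 / 4 - q⁻¹ * (p.1 - p.2) ^ 2 / 4 : ℝ) +
        ((√2 * b * (p.1 - p.2) : ℝ) : ℂ) * Complex.I) := by
  refine (integrable_exp_neg_sq_prod (half_pos hq0)).mono'
    (Continuous.aestronglyMeasurable (by fun_prop)) (Filter.Eventually.of_forall fun p => ?_)
  rw [Complex.exp_add, norm_mul, Complex.norm_exp_ofReal_mul_I, mul_one, Complex.norm_exp_ofReal,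
    ← Real.exp_add, Real.exp_le_exp]
  have h1 : q ≤ q⁻¹ := hq1.trans (one_le_inv_iff₀.2 ⟨hq0, hq1⟩)
  have h2 := mul_le_mul_of_nonneg_right h1 (sq_nonneg (p.1 - p.2))
  have h3 : 0 ≤ q * ((p.1 - A) + (p.2 - A)) ^ 2 := by positivity
  nlinarith [mul_nonneg (inv_nonneg.2 hq0.le) (sq_nonneg (p.1 - p.2))]

/-- Two successive Gaussian integrations whose leading coefficients are mutually inverse, so the
prefactor is `π`. With `A = √2 Re a` and `b = Im a` the result decays as `e^{-q|a|²}`. -/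
theorem integral_mehlerKernel_exponent {q : ℝ} (hq0 : 0 < q) (hq1 : q ≤ 1) (A b : ℝ) :
    ∫ p : ℝ × ℝ, Complex.exp
      ((-(q * (p.1 + p.2) ^ 2 / 4) - q⁻¹ * (p.1 - p.2) ^ 2 / 4 -
        q * ((p.1 - A) + (p.2 - A)) ^ 2 / 4 - q⁻¹ * (p.1 - p.2) ^ 2 / 4 : ℝ) +
        ((√2 * b * (p.1 - p.2) : ℝ) : ℂ) * Complex.I) =
      ((π * Real.exp (-(q * (A ^ 2 / 2 + b ^ 2))) : ℝ) : ℂ) := by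
  have hs : (√2 : ℂ) ^ 2 = 2 := by exact_mod_cast Real.sq_sqrt (by norm_num : (0 : ℝ) ≤ 2)
  have hq : (q : ℂ) ≠ 0 := by exact_mod_cast hq0.ne'
  have hq2' : (q ^ 2 + 1 : ℝ) ≠ 0 := by positivity
  have hq2 : (q ^ 2 + 1 : ℂ) ≠ 0 := by exact_mod_cast hq2'
  have hP : 0 < (q ^ 2 + 1) / (2 * q) := by positivity
  have hP' : 0 < 2 * q / (q ^ 2 + 1) := by positivity
  rw [Measure.volume_eq_prod, integral_prod _ (integrable_mehlerKernel_exponent hq0 hq1 A b)]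
  set β : ℂ := (√2 : ℂ) * b * Complex.I with hβ
  have hβ2 : β ^ 2 = -2 * b ^ 2 := by
    rw [hβ]
    linear_combination (b : ℂ) ^ 2 * (Complex.I ^ 2 * hs + 2 * Complex.I_sq)
  have e1 : ∀ x : ℝ, ∫ y : ℝ, Complex.exp
      ((-(q * (x + y) ^ 2 / 4) - q⁻¹ * (x - y) ^ 2 / 4 -
        q * ((x - A) + (y - A)) ^ 2 / 4 - q⁻¹ * (x - y) ^ 2 / 4 : ℝ) +
        ((√2 * b * (x - y) : ℝ) : ℂ) * Complex.I) =
      (√(π / ((q ^ 2 + 1) / (2 * q))) : ℂ) *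
        Complex.exp (-((2 * q / (q ^ 2 + 1) : ℝ) : ℂ) * x ^ 2 +
        (2 * q ^ 2 * β / (q ^ 2 + 1) + 2 * q * A / (q ^ 2 + 1)) * x +
        (-(q * A ^ 2) + (q * A - β) ^ 2 * q / (2 * (q ^ 2 + 1)))) := fun x => by
    have h := integral_cexp_quadratic_ofReal hP (-(q * x) + q * A + x / q - β)
      (-(q * (x ^ 2 + (x - 2 * A) ^ 2) / 4) - x ^ 2 / (2 * q) + β * x)
    refine Eq.trans ?_ (h.trans ?_)
    · congr 1
      funext y
      congr 1
      push_cast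
      field_simp
      rw [hβ]
      ring
    · congr 2
      push_cast
      field_simp
      ring
  simp_rw [e1]
  rw [integral_const_mul, integral_cexp_quadratic_ofReal hP', ← mul_assoc, ← Complex.ofReal_mul,
    ← Real.sqrt_mul (by positivity), Complex.ofReal_mul, Complex.ofReal_exp]
  congr 1
  · congr 1
    rw [show π / ((q ^ 2 + 1) / (2 * q)) * (π / (2 * q / (q ^ 2 + 1))) = π ^ 2 by
      field_simp]
    exact Real.sqrt_sq Real.pi_pos.le
  · congr 1
    have e3 : (-(q * A ^ 2) + (q * A - β) ^ 2 * q / (2 * (q ^ 2 + 1)) +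
        (2 * q ^ 2 * β / (q ^ 2 + 1) + 2 * q * A / (q ^ 2 + 1)) ^ 2 /
          (4 * (2 * q / (q ^ 2 + 1))) : ℂ) = -(q * A ^ 2) / 2 + q * β ^ 2 / 2 := by
      field_simp
      ring
    push_cast
    rw [e3, hβ2]
    ring

theorem integrable_hermiteFn_mul_displaced (a : ℂ) (j k : ℕ) :
    Integrable fun x : ℝ => (hermiteFn j x : ℂ) *
      (Complex.exp (((√2 * a.im * x - a.re * a.im : ℝ) : ℂ) * Complex.I) *
        (hermiteFn k (x - √2 * a.re) : ℂ)) := by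
  have hj := continuous_hermiteFn j
  have hk := continuous_hermiteFn k
  refine ((integrable_hermiteFn_sq j).add
    ((integrable_hermiteFn_sq k).comp_sub_right (√2 * a.re))).mono'
    (Continuous.aestronglyMeasurable (by fun_prop)) (Filter.Eventually.of_forall fun x => ?_)
  rw [norm_mul, norm_mul, Complex.norm_exp_ofReal_mul_I, one_mul, Complex.norm_real,
    Complex.norm_real, Real.norm_eq_abs, Real.norm_eq_abs, Pi.add_apply,
    ← sq_abs (hermiteFn j x), ← sq_abs (hermiteFn k _)]
  nlinarith [sq_nonneg (|hermiteFn j x| - |hermiteFn k (x - √2 * a.re)|),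
    sq_nonneg |hermiteFn j x|, sq_nonneg |hermiteFn k (x - √2 * a.re)|]

theorem mehlerKernel_mul_mehlerKernel {t : ℝ} (ht0 : 0 ≤ t) (ht1 : t < 1) (x y A : ℝ) :
    mehlerKernel t x y * mehlerKernel t (x - A) (y - A) = (π * (1 - t ^ 2))⁻¹ *
      Real.exp (-((1 - t) / (1 + t) * (x + y) ^ 2 / 4) -
        ((1 - t) / (1 + t))⁻¹ * (x - y) ^ 2 / 4 -
        (1 - t) / (1 + t) * ((x - A) + (y - A)) ^ 2 / 4 -
        ((1 - t) / (1 + t))⁻¹ * (x - y) ^ 2 / 4) := by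
  have hpos : 0 < 1 - t ^ 2 := by nlinarith
  have e : (√(π * (1 - t ^ 2)))⁻¹ * (√(π * (1 - t ^ 2)))⁻¹ = (π * (1 - t ^ 2))⁻¹ := by
    rw [← mul_inv, Real.mul_self_sqrt (by positivity)]
  unfold mehlerKernel
  rw [mul_mul_mul_comm, e, ← Real.exp_add, inv_div]
  congr 2
  ring

/-- `∑ t^{j+k} |⟨j|D(a)|k⟩|² = (1 - t²)⁻¹ e^{-|a|² (1 - t)/(1 + t)}`. -/
theorem hasSum_displacementElem {t : ℝ} (ht0 : 0 ≤ t) (ht1 : t < 1) (a : ℂ) :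
    HasSum (fun p : ℕ × ℕ => ((t ^ p.1 * t ^ p.2 : ℝ) : ℂ) *
      (displacementElem a p.1 p.2 * starRingEnd ℂ (displacementElem a p.1 p.2)))
      (((1 - t ^ 2)⁻¹ * Real.exp (-((1 - t) / (1 + t) * ‖a‖ ^ 2)) : ℝ) : ℂ) := by
  have hpos : 0 < 1 - t ^ 2 := by nlinarith
  set A : ℝ := √2 * a.re with hA
  set f : ℕ → ℕ → ℝ → ℂ := fun j k x => (hermiteFn j x : ℂ) *
      (Complex.exp (((√2 * a.im * x - a.re * a.im : ℝ) : ℂ) * Complex.I) *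
        (hermiteFn k (x - A) : ℂ)) with hf
  -- Writing `|∫ f|²` as a double integral of `f(x)` times the conjugate of `f(y)` lets the sums
  -- over `j` and `k` be done under the integral.
  set G : ℕ × ℕ → ℝ × ℝ → ℂ := fun p z => ((t ^ p.1 * t ^ p.2 : ℝ) : ℂ) *
    (f p.1 p.2 z.1 * starRingEnd ℂ (f p.1 p.2 z.2)) with hG
  have hfi : ∀ j k, Integrable (f j k) := integrable_hermiteFn_mul_displaced a
  have hfc : ∀ j k, Integrable fun x => starRingEnd ℂ (f j k x) := fun j k =>
    (LinearIsometryEquiv.integrable_comp_iff Complex.conjLIE).2 (hfi j k)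
  have hGi : ∀ p, Integrable (G p) := fun p => ((hfi p.1 p.2).mul_prod (hfc p.1 p.2)).const_mul _
  have hNk : ∀ k : ℕ, Integrable fun x => hermiteFn k (x - A) ^ 2 := fun k =>
    (integrable_hermiteFn_sq k).comp_sub_right A
  have hNk' : ∀ k : ℕ, ∫ x, hermiteFn k (x - A) ^ 2 = ∫ x, hermiteFn k x ^ 2 := fun k =>
    integral_sub_right_eq_self (fun x => hermiteFn k x ^ 2) A
  have hGn : ∀ p : ℕ × ℕ, ∫ z, ‖G p z‖ ≤ (t ^ p.1 * ∫ x, hermiteFn p.1 x ^ 2) *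
      (t ^ p.2 * ∫ x, hermiteFn p.2 x ^ 2) := fun p => by
    have i1 : Integrable fun z : ℝ × ℝ => hermiteFn p.1 z.1 ^ 2 * hermiteFn p.2 (z.2 - A) ^ 2 :=
      (integrable_hermiteFn_sq p.1).mul_prod (hNk p.2)
    have i2 : Integrable fun z : ℝ × ℝ => hermiteFn p.2 (z.1 - A) ^ 2 * hermiteFn p.1 z.2 ^ 2 :=
      (hNk p.2).mul_prod (integrable_hermiteFn_sq p.1)
    have h1 : ∫ z, ‖G p z‖ ≤ ∫ z : ℝ × ℝ, (t ^ p.1 * t ^ p.2 / 2) *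
        (hermiteFn p.1 z.1 ^ 2 * hermiteFn p.2 (z.2 - A) ^ 2 +
          hermiteFn p.2 (z.1 - A) ^ 2 * hermiteFn p.1 z.2 ^ 2) := by
      refine integral_mono (hGi p).norm ((i1.add i2).const_mul _) fun z => ?_
      simp only [hG, hf]
      rw [norm_mul, norm_mul, RCLike.norm_conj, norm_mul, norm_mul, norm_mul, norm_mul,
        Complex.norm_exp_ofReal_mul_I, Complex.norm_exp_ofReal_mul_I, Complex.norm_real,
        Complex.norm_real, Complex.norm_real, Complex.norm_real, Complex.norm_real,
        Real.norm_of_nonneg (by positivity : (0 : ℝ) ≤ t ^ p.1 * t ^ p.2), div_mul_eq_mul_div,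
        mul_div_assoc]
      refine mul_le_mul_of_nonneg_left ?_ (by positivity)
      simp only [Real.norm_eq_abs]
      rw [← sq_abs (hermiteFn p.1 z.1), ← sq_abs (hermiteFn p.1 z.2),
        ← sq_abs (hermiteFn p.2 (z.1 - A)), ← sq_abs (hermiteFn p.2 (z.2 - A))]
      nlinarith [sq_nonneg (|hermiteFn p.1 z.1| * |hermiteFn p.2 (z.2 - A)| -
        |hermiteFn p.2 (z.1 - A)| * |hermiteFn p.1 z.2|)]
    refine h1.trans (le_of_eq ?_)
    rw [integral_const_mul, integral_add i1 i2, Measure.volume_eq_prod,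
      integral_prod_mul (fun x => hermiteFn p.1 x ^ 2) (fun x => hermiteFn p.2 (x - A) ^ 2),
      integral_prod_mul (fun x => hermiteFn p.2 (x - A) ^ 2) (fun x => hermiteFn p.1 x ^ 2), hNk']
    ring
  have hN := summable_pow_mul_integral_hermiteFn_sq ht0 ht1
  have hN0 : 0 ≤ fun k : ℕ => t ^ k * ∫ x, hermiteFn k x ^ 2 := fun k =>
    mul_nonneg (pow_nonneg ht0 k) (integral_hermiteFn_sq_nonneg k)
  have hsum : Summable fun p => ∫ z, ‖G p z‖ :=
    (hN.mul_of_nonneg hN hN0 hN0).of_nonneg_of_le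
      (fun p => integral_nonneg fun z => norm_nonneg _) hGn
  have h := hasSum_integral_of_summable_integral_norm hGi hsum
  have e1 : ∀ p, ∫ z, G p z = ((t ^ p.1 * t ^ p.2 : ℝ) : ℂ) *
      (displacementElem a p.1 p.2 * starRingEnd ℂ (displacementElem a p.1 p.2)) := fun p => by
    simp only [hG]
    rw [integral_const_mul, Measure.volume_eq_prod, integral_prod_mul (f p.1 p.2)
      (fun x => starRingEnd ℂ (f p.1 p.2 x)), integral_conj]
    rfl
  -- The double series is a product of two Mehler kernels, one displaced by `A`; of the phases only
  -- the part in `z.1 - z.2` survives.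
  have e2 : ∀ z, ∑' p, G p z = (((π * (1 - t ^ 2))⁻¹ : ℝ) : ℂ) * Complex.exp
      ((-((1 - t) / (1 + t) * (z.1 + z.2) ^ 2 / 4) - ((1 - t) / (1 + t))⁻¹ * (z.1 - z.2) ^ 2 / 4 -
        (1 - t) / (1 + t) * ((z.1 - A) + (z.2 - A)) ^ 2 / 4 -
          ((1 - t) / (1 + t))⁻¹ * (z.1 - z.2) ^ 2 / 4 : ℝ) +
        ((√2 * a.im * (z.1 - z.2) : ℝ) : ℂ) * Complex.I) := fun z => by
    have h1 := hasSum_hermiteFn_mul_hermiteFn ht0 ht1 z.1 z.2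
    have h2 := hasSum_hermiteFn_mul_hermiteFn ht0 ht1 (z.1 - A) (z.2 - A)
    have h3 := h1.mul h2 (summable_mul_of_summable_norm h1.summable.norm h2.summable.norm)
    rw [mehlerKernel_mul_mehlerKernel ht0 ht1] at h3
    have h4 := (Complex.hasSum_ofReal.2 h3).mul_right
      (Complex.exp (((√2 * a.im * (z.1 - z.2) : ℝ) : ℂ) * Complex.I))
    have e3 : ∀ p : ℕ × ℕ, ((t ^ p.1 * (hermiteFn p.1 z.1 * hermiteFn p.1 z.2) *
        (t ^ p.2 * (hermiteFn p.2 (z.1 - A) * hermiteFn p.2 (z.2 - A))) : ℝ) : ℂ) *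
        Complex.exp (((√2 * a.im * (z.1 - z.2) : ℝ) : ℂ) * Complex.I) = G p z := fun p => by
      have e4 : Complex.exp (((√2 * a.im * (z.1 - z.2) : ℝ) : ℂ) * Complex.I) =
          Complex.exp (((√2 * a.im * z.1 - a.re * a.im : ℝ) : ℂ) * Complex.I) *
          starRingEnd ℂ (Complex.exp (((√2 * a.im * z.2 - a.re * a.im : ℝ) : ℂ) * Complex.I)) := by
        rw [← Complex.exp_conj, map_mul, Complex.conj_I, Complex.conj_ofReal, ← Complex.exp_add]
        congr 1
        push_cast
        ring
      simp only [hG, hf]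
      rw [e4]
      simp only [map_mul, Complex.conj_ofReal]
      push_cast
      ring
    simp_rw [e3] at h4
    rw [h4.tsum_eq, Complex.ofReal_mul, Complex.ofReal_exp, mul_assoc, ← Complex.exp_add]
  simp_rw [e1, e2] at h
  have hq0 : 0 < (1 - t) / (1 + t) := div_pos (by linarith) (by linarith)
  have hq1 : (1 - t) / (1 + t) ≤ 1 := (div_le_one (by linarith)).2 (by linarith)
  rw [integral_const_mul, integral_mehlerKernel_exponent hq0 hq1, ← Complex.ofReal_mul] at h
  have e3 : (π * (1 - t ^ 2))⁻¹ * (π * Real.exp (-((1 - t) / (1 + t) * (A ^ 2 / 2 + a.im ^ 2)))) =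
      (1 - t ^ 2)⁻¹ * Real.exp (-((1 - t) / (1 + t) * ‖a‖ ^ 2)) := by
    rw [mul_inv, mul_mul_mul_comm, inv_mul_cancel₀ Real.pi_ne_zero, one_mul]
    congr 4
    rw [Complex.sq_norm, Complex.normSq_apply, hA, mul_pow, Real.sq_sqrt (by norm_num)]
    ring
  rwa [e3] at h

end Mehler

/-! ### Several modes -/

/-- Induction splitting off one coordinate; absolute convergence is carried along because the
product of two series requires it. -/
theorem hasSum_prod_pi_and_summable_norm {ι 𝕜 : Type*} [NormedField 𝕜] [CompleteSpace 𝕜] {n : ℕ}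
    {f : Fin n → ι → 𝕜} {S : Fin n → 𝕜} (hf : ∀ i, HasSum (f i) (S i))
    (hn : ∀ i, Summable fun k => ‖f i k‖) :
    HasSum (fun p : Fin n → ι => ∏ i, f i (p i)) (∏ i, S i) ∧
      Summable fun p : Fin n → ι => ‖∏ i, f i (p i)‖ := by
  induction n with
  | zero =>
    have h := hasSum_unique (fun p : Fin 0 → ι => ∏ i, f i (p i))
    have h' := hasSum_unique (fun p : Fin 0 → ι => ‖∏ i, f i (p i)‖)
    refine ⟨?_, h'.summable⟩
    rwa [Fin.prod_univ_zero] at h ⊢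
  | succ n ih =>
    obtain ⟨h1, h2⟩ := ih (fun i => hf i.succ) fun i => hn i.succ
    set g : (Fin n → ι) → 𝕜 := fun p => ∏ i, f i.succ (p i)
    have h3 : Summable fun x : ι × (Fin n → ι) => ‖f 0 x.1 * g x.2‖ := (hn 0).mul_norm h2
    have h4 := (hf 0).mul h1 h3.of_norm
    have e : ∀ x : ι × (Fin n → ι),
        ∏ i, f i ((Fin.consEquiv fun _ => ι) x i) = f 0 x.1 * g x.2 := fun x => by
      simp [Fin.consEquiv, Fin.prod_univ_succ, g]
    rw [Fin.prod_univ_succ, ← (Fin.consEquiv fun _ => ι).hasSum_iff,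
      ← (Fin.consEquiv fun _ => ι).summable_iff]
    simp only [Function.comp_def, e]
    exact ⟨h4, h3⟩

/-! ### The Bell slice of the two-mode squeezed vacuum -/

section TMSV

variable {n : ℕ}

theorem summable_norm_tmsv {t : ℝ} (ht0 : 0 ≤ t) (ht1 : t < 1) :
    Summable fun k : Fin n → ℕ => t ^ (∑ i, k i) * (‖numberState k‖ * ‖numberState k‖) := by
  have h0 := summable_pow_mul_integral_hermiteFn_sq ht0 ht1
  have h := (hasSum_prod_pi_and_summable_norm (n := n) (fun _ => h0.hasSum) fun _ => h0.norm).1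
  refine h.summable.congr fun k => ?_
  rw [← sq, norm_numberState_sq, Finset.prod_mul_distrib, Finset.prod_pow_eq_pow_sum]

/-- The unnormalised two-mode squeezed vacuum `∑ₖ t^{|k|} |k⟩|k⟩`. -/
def squeezedSum (n : ℕ) (t : ℝ) : PairSpace n :=
  ∑' k : Fin n → ℕ, ((t ^ (∑ i, k i) : ℝ) : ℂ) • vecTensor (numberState k) (numberState k)

theorem tmsv_eq_smul (r : ℝ) :
    tmsv n r = ((Real.cosh r ^ n)⁻¹ : ℂ) • squeezedSum n (Real.tanh r) := rfl

theorem norm_squeezedSum_term {t : ℝ} (ht0 : 0 ≤ t) (k : Fin n → ℕ) :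
    ‖((t ^ (∑ i, k i) : ℝ) : ℂ) • vecTensor (numberState k) (numberState k)‖ =
      t ^ (∑ i, k i) * (‖numberState k‖ * ‖numberState k‖) := by
  rw [norm_smul, Complex.norm_real, Real.norm_of_nonneg (by positivity), norm_vecTensor]

theorem hasSum_squeezedSum {t : ℝ} (ht0 : 0 ≤ t) (ht1 : t < 1) :
    HasSum (fun k : Fin n → ℕ => ((t ^ (∑ i, k i) : ℝ) : ℂ) •
      vecTensor (numberState k) (numberState k)) (squeezedSum n t) := by
  refine Summable.hasSum (Summable.of_norm ?_)
  simp_rw [norm_squeezedSum_term ht0]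
  exact summable_norm_tmsv ht0 ht1

/-- Expanding both slots gives a double series over `j` and `k` which factors over the modes; each
factor is the one-mode sum `hasSum_displacementElem`. -/
theorem inner_squeezedSum {t : ℝ} (ht0 : 0 ≤ t) (ht1 : t < 1) (α : Phase n) :
    ⟪squeezedSum n t, opTensor (displacement α) (displacement (star α)) (squeezedSum n t)⟫_ℂ =
      ((((1 - t ^ 2)⁻¹) ^ n * Real.exp (-((1 - t) / (1 + t) * normSqSum α)) : ℝ) : ℂ) := by
  set X := opTensor (displacement α) (displacement (star α))
  set v : (Fin n → ℕ) → PairSpace n := fun k =>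
    ((t ^ (∑ i, k i) : ℝ) : ℂ) • vecTensor (numberState k) (numberState k) with hv
  have h1 := (hasSum_prod_pi_and_summable_norm
    (fun i => hasSum_displacementElem ht0 ht1 (α i))
    fun i => (hasSum_displacementElem ht0 ht1 (α i)).summable.norm).1
  have e1 : ∏ i, (((1 - t ^ 2)⁻¹ * Real.exp (-((1 - t) / (1 + t) * ‖α i‖ ^ 2)) : ℝ) : ℂ) =
      ((((1 - t ^ 2)⁻¹) ^ n * Real.exp (-((1 - t) / (1 + t) * normSqSum α)) : ℝ) : ℂ) := by
    rw [← Complex.ofReal_prod, Finset.prod_mul_distrib, ← exp_normSqSum_eq_prod, Finset.prod_const,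
      Finset.card_univ, Fintype.card_fin]
  rw [e1, ← (Equiv.arrowProdEquivProdArrow (Fin n) (fun _ => ℕ) (fun _ => ℕ)).symm.hasSum_iff] at h1
  have h2 : HasSum (fun p : (Fin n → ℕ) × (Fin n → ℕ) => ⟪v p.1, X (v p.2)⟫_ℂ)
      ((((1 - t ^ 2)⁻¹) ^ n * Real.exp (-((1 - t) / (1 + t) * normSqSum α)) : ℝ) : ℂ) := by
    have e2 : (fun p : (Fin n → ℕ) × (Fin n → ℕ) => ⟪v p.1, X (v p.2)⟫_ℂ) =
        (fun p : Fin n → ℕ × ℕ => ∏ i, (((t ^ (p i).1 * t ^ (p i).2 : ℝ) : ℂ) *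
          (displacementElem (α i) (p i).1 (p i).2 *
            starRingEnd ℂ (displacementElem (α i) (p i).1 (p i).2)))) ∘
        (Equiv.arrowProdEquivProdArrow (Fin n) (fun _ => ℕ) (fun _ => ℕ)).symm := by
      funext p
      simp only [hv, X, Function.comp_apply, Equiv.arrowProdEquivProdArrow_symm_apply]
      rw [map_smul, inner_smul_left, inner_smul_right, opTensor_vecTensor, inner_vecTensor,
        inner_numberState_displacement, inner_numberState_displacement_star, Complex.conj_ofReal,
        Finset.prod_mul_distrib, Finset.prod_mul_distrib, ← Complex.ofReal_prod,
        Finset.prod_mul_distrib, Finset.prod_pow_eq_pow_sum, Finset.prod_pow_eq_pow_sum,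
        Complex.ofReal_mul, mul_assoc]
    rw [e2]
    exact h1
  -- Summing first over the right slot, then over the left, identifies the value of the double
  -- series with the inner product.
  have h3 : ∀ j, HasSum (fun k => ⟪v j, X (v k)⟫_ℂ) ⟪v j, X (squeezedSum n t)⟫_ℂ := fun j =>
    (hasSum_squeezedSum ht0 ht1).mapL ((innerSL ℂ (v j)) ∘L X)
  have h4 := h2.prod_fiberwise h3
  have h5 : HasSum (fun j => ⟪v j, X (squeezedSum n t)⟫_ℂ)
      ⟪squeezedSum n t, X (squeezedSum n t)⟫_ℂ := by
    have h6 := (hasSum_squeezedSum (n := n) ht0 ht1).mapL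
      (innerSL ℂ (X (squeezedSum n t)))
    have h7 : HasSum (starRingEnd ℂ ∘ fun k => ⟪X (squeezedSum n t), v k⟫_ℂ)
      (starRingEnd ℂ ⟪X (squeezedSum n t), squeezedSum n t⟫_ℂ) :=
      h6.map (starRingEnd ℂ) Complex.continuous_conj
    have e2 : (starRingEnd ℂ ∘ fun k => ⟪X (squeezedSum n t), v k⟫_ℂ) =
        fun j => ⟪v j, X (squeezedSum n t)⟫_ℂ := funext fun j => inner_conj_symm _ _
    rwa [e2, inner_conj_symm] at h7
  exact h5.unique h4

theorem tanh_nonneg_lt_one {r : ℝ} (hr : 0 ≤ r) : 0 ≤ Real.tanh r ∧ Real.tanh r < 1 := by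
  have h1 := Real.cosh_pos r
  have h2 := Real.sinh_nonneg_iff.2 hr
  rw [Real.tanh_eq_sinh_div_cosh]
  exact ⟨by positivity, (div_lt_one h1).2 (Real.sinh_lt_cosh r)⟩

/-- For `t = tanh r`, `(1 - t²)⁻¹ = cosh² r` cancels the normalisation and `(1 - t)/(1 + t) =
e^{-2r}`. -/
theorem inner_tmsv {r : ℝ} (hr : 0 ≤ r) (α : Phase n) :
    ⟪tmsv n r, opTensor (displacement α) (displacement (star α)) (tmsv n r)⟫_ℂ =
      ((Real.exp (-(Real.exp (-2 * r) * normSqSum α)) : ℝ) : ℂ) := by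
  obtain ⟨ht0, ht1⟩ := tanh_nonneg_lt_one hr
  have hc := Real.cosh_pos r
  have e1 : 1 - Real.tanh r ^ 2 = (Real.cosh r ^ 2)⁻¹ := by
    rw [Real.tanh_eq_sinh_div_cosh, div_pow]
    field_simp
    linarith [Real.cosh_sq r]
  have e2 : (1 - Real.tanh r) / (1 + Real.tanh r) = Real.exp (-2 * r) := by
    have h1 : Real.cosh r + Real.sinh r ≠ 0 := by
      rw [Real.cosh_add_sinh]
      exact (Real.exp_pos r).ne'
    rw [Real.tanh_eq_sinh_div_cosh]
    have h2 : (1 - Real.sinh r / Real.cosh r) / (1 + Real.sinh r / Real.cosh r) =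
        (Real.cosh r - Real.sinh r) / (Real.cosh r + Real.sinh r) := by
      field_simp
    rw [h2, Real.cosh_add_sinh, Real.cosh_sub_sinh, ← Real.exp_sub]
    congr 1
    ring
  rw [tmsv_eq_smul, map_smul, inner_smul_left, inner_smul_right, inner_squeezedSum ht0 ht1, e1, e2]
  rw [inv_inv, ← pow_mul, mul_comm 2 n, pow_mul]
  have hc' : (Real.cosh r : ℂ) ≠ 0 := by exact_mod_cast hc.ne'
  rw [map_inv₀, map_pow, Complex.conj_ofReal]
  push_cast at hc' ⊢
  field_simp

/-- Each term is continuous by strong continuity, and displacements preserve the norms of the terms,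
so the series converges uniformly in `β`. -/
theorem continuous_opTensor_displacement_tmsv {r : ℝ} (hr : 0 ≤ r) :
    Continuous fun β : Phase n => opTensor (displacement β) 1 (tmsv n r) := by
  obtain ⟨ht0, ht1⟩ := tanh_nonneg_lt_one hr
  have h : ∀ β : Phase n, opTensor (displacement β) 1 (squeezedSum n (Real.tanh r)) =
      ∑' k : Fin n → ℕ, ((Real.tanh r ^ (∑ i, k i) : ℝ) : ℂ) •
        vecTensor (displacement β (numberState k)) (numberState k) := fun β => by
    have h1 := (hasSum_squeezedSum ht0 ht1).mapL (opTensor (displacement β) 1)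
    rw [← h1.tsum_eq]
    refine tsum_congr fun k => ?_
    rw [map_smul, opTensor_vecTensor]
    rfl
  simp_rw [tmsv_eq_smul, map_smul, h]
  have hc : ∀ k : Fin n → ℕ, Continuous fun β : Phase n =>
      ((Real.tanh r ^ (∑ i, k i) : ℝ) : ℂ) •
        vecTensor (displacement β (numberState k)) (numberState k) := fun k => by
    have h1 : Continuous fun β : Phase n => vecTensor (displacement β (numberState k))
        (numberState k) :=
      ((vecTensorL n).flip (numberState k)).continuous.comp (continuous_displacement_apply _)
    exact (continuous_const_smul ((Real.tanh r ^ (∑ i, k i) : ℝ) : ℂ)).comp h1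
  refine (continuous_const_smul ((Real.cosh r ^ n)⁻¹ : ℂ)).comp
    (continuous_tsum hc (summable_norm_tmsv ht0 ht1) fun k β => ?_)
  rw [norm_smul, Complex.norm_real, Real.norm_of_nonneg (by positivity), norm_vecTensor,
    norm_displacement_apply]

end TMSV

/-! ### The channel-learning scheme -/

section Channel

variable {n : ℕ}

theorem opTensor_smul_left (c : ℂ) (A B : Op (ModeSpace n)) :
    opTensor (c • A) B = c • opTensor A B :=
  continuousLinearMap_ext_vecTensor fun f g => by
    rw [smul_apply, opTensor_vecTensor, opTensor_vecTensor, smul_apply,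
      ← vecTensorL_apply, map_smul]
    rfl

theorem opTensor_one_one : opTensor (1 : Op (ModeSpace n)) 1 = 1 :=
  continuousLinearMap_ext_vecTensor fun f g => by
    rw [opTensor_vecTensor]
    rfl

theorem adjoint_one_op : ContinuousLinearMap.adjoint (1 : Op (ModeSpace n)) = 1 :=
  star_one (Op (ModeSpace n))

theorem norm_opTensor_displacement_apply (β : Phase n) (Ψ : PairSpace n) :
    ‖opTensor (displacement β) 1 Ψ‖ = ‖Ψ‖ := by
  refine (ContinuousLinearMap.norm_map_iff_adjoint_comp_self _).2 ?_ Ψ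
  rw [adjoint_opTensor, opTensor_comp, adjoint_displacement_comp_self, adjoint_one_op]
  exact opTensor_one_one

theorem inner_displaced_eq (α β : Phase n) (B : Op (ModeSpace n)) (Ψ : PairSpace n) :
    ⟪opTensor (displacement β) 1 Ψ,
      opTensor (displacement α) B (opTensor (displacement β) 1 Ψ)⟫_ℂ =
      sympChar β α * ⟪Ψ, opTensor (displacement α) B Ψ⟫_ℂ := by
  have h : ContinuousLinearMap.adjoint (opTensor (displacement β) 1) ∘L
      opTensor (displacement α) B ∘L opTensor (displacement β) 1 =
      sympChar β α • opTensor (displacement α) B := by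
    rw [adjoint_opTensor, opTensor_comp, opTensor_comp, displacement_conj, opTensor_smul_left,
      adjoint_one_op]
    rfl
  exact (ContinuousLinearMap.adjoint_inner_right (opTensor (displacement β) 1) Ψ
    (opTensor (displacement α) B (opTensor (displacement β) 1 Ψ))).symm.trans
    ((congrArg (fun T : Op (PairSpace n) => ⟪Ψ, T Ψ⟫_ℂ) h).trans
      (inner_smul_right Ψ (opTensor (displacement α) B Ψ) (sympChar β α)))

theorem conjOp_rankOne {K : Type*} [NormedAddCommGroup K] [InnerProductSpace ℂ K] [CompleteSpace K]
    (V : Op K) (Ψ : K) :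
    conjOp V (InnerProductSpace.rankOne ℂ Ψ Ψ) = InnerProductSpace.rankOne ℂ (V Ψ) (V Ψ) := by
  ext x
  simp [conjOp, ContinuousLinearMap.adjoint_inner_right]

/-- The trace against a mixture of pure states. -/
theorem opTrace_integral_rankOne_comp {K Ω : Type*} [NormedAddCommGroup K] [InnerProductSpace ℂ K]
    [CompleteSpace K] [TopologicalSpace.SeparableSpace K] [TopologicalSpace Ω] [MeasurableSpace Ω]
    [OpensMeasurableSpace Ω] [SecondCountableTopology Ω] (p : Measure Ω) [IsFiniteMeasure p]
    {ψ : Ω → K} (hψ : Continuous ψ) {C : ℝ} (hC : ∀ ω, ‖ψ ω‖ = C) (X : Op K) :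
    opTrace ((∫ ω, InnerProductSpace.rankOne ℂ (ψ ω) (ψ ω) ∂p) ∘L X) =
      ∫ ω, ⟪ψ ω, X (ψ ω)⟫_ℂ ∂p := by
  set e := traceBasis K
  have : Countable (exists_hilbertBasis ℂ K).choose := countable_of_hilbertBasis e
  set X' := ContinuousLinearMap.adjoint X
  have hc : Continuous fun ω => (InnerProductSpace.rankOne ℂ (ψ ω) (ψ ω) : Op K) :=
    (ContinuousLinearMap.smulRightL ℂ K K).continuous₂.comp
      (((innerSL ℂ).continuous.comp hψ).prodMk hψ)
  have hI : Integrable (fun ω => (InnerProductSpace.rankOne ℂ (ψ ω) (ψ ω) : Op K)) p := by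
    refine (integrable_const (C * C)).mono' hc.aestronglyMeasurable
      (Filter.Eventually.of_forall fun ω => ?_)
    rw [InnerProductSpace.norm_rankOne, hC]
  have h1 : ∀ i, ⟪e i, ((∫ ω, InnerProductSpace.rankOne ℂ (ψ ω) (ψ ω) ∂p) ∘L X) (e i)⟫_ℂ =
      ∫ ω, ⟪X' (ψ ω), e i⟫_ℂ * ⟪e i, ψ ω⟫_ℂ ∂p := fun i => by
    have h := ((innerSL ℂ (e i)) ∘L (ContinuousLinearMap.apply ℂ K (X (e i)))).integral_comp_comm hI
    refine h.symm.trans (integral_congr_ae (Filter.Eventually.of_forall fun ω => ?_))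
    simp [X', ContinuousLinearMap.adjoint_inner_left]
  -- The dominating terms sum, by Parseval, to `‖X'ψ‖² + ‖ψ‖²`, which the constant norm of `ψ`
  -- bounds uniformly.
  have h2 := hasSum_integral_of_dominated_convergence (μ := p)
    (F := fun i ω => ⟪X' (ψ ω), e i⟫_ℂ * ⟪e i, ψ ω⟫_ℂ) (f := fun ω => ⟪X' (ψ ω), ψ ω⟫_ℂ)
    (fun i ω => ‖⟪e i, X' (ψ ω)⟫_ℂ‖ ^ 2 + ‖⟪e i, ψ ω⟫_ℂ‖ ^ 2)
    (fun i => Continuous.aestronglyMeasurable (by fun_prop))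
    (fun i => Filter.Eventually.of_forall fun ω => by
      rw [norm_mul, norm_inner_symm]
      nlinarith [sq_nonneg (‖⟪e i, X' (ψ ω)⟫_ℂ‖ - ‖⟪e i, ψ ω⟫_ℂ‖),
        sq_nonneg ‖⟪e i, X' (ψ ω)⟫_ℂ‖, sq_nonneg ‖⟪e i, ψ ω⟫_ℂ‖])
    (Filter.Eventually.of_forall fun ω =>
      ((hasSum_norm_inner_sq e _).add (hasSum_norm_inner_sq e _)).summable)
    (by
      simp_rw [fun ω => ((hasSum_norm_inner_sq e (X' (ψ ω))).add
        (hasSum_norm_inner_sq e (ψ ω))).tsum_eq]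
      refine (integrable_const ((‖X'‖ * C) ^ 2 + C ^ 2)).mono'
        (Continuous.aestronglyMeasurable (by fun_prop)) (Filter.Eventually.of_forall fun ω => ?_)
      rw [Real.norm_of_nonneg (by positivity), hC]
      have h3 := X'.le_opNorm (ψ ω)
      rw [hC] at h3
      gcongr)
    (Filter.Eventually.of_forall fun ω => e.hasSum_inner_mul_inner _ _)
  have h3 : opTrace ((∫ ω, InnerProductSpace.rankOne ℂ (ψ ω) (ψ ω) ∂p) ∘L X) =
      ∑' i, ⟪e i, ((∫ ω, InnerProductSpace.rankOne ℂ (ψ ω) (ψ ω) ∂p) ∘L X) (e i)⟫_ℂ := rfl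
  rw [h3]
  simp_rw [h1]
  rw [h2.tsum_eq]
  simp only [X', ContinuousLinearMap.adjoint_inner_left]

theorem bellSlice_channelLearningState (p : Measure (Phase n)) [IsFiniteMeasure p] {r : ℝ}
    (hr : 0 ≤ r) (α : Phase n) :
    bellSlice (channelLearningState p r) α = (∫ β, sympChar β α ∂p) *
      (Real.exp (-(Real.exp (-2 * r) * normSqSum α)) : ℂ) := by
  have := separableSpace_pairSpace (n := n)
  unfold bellSlice channelLearningState randomDisplacementFst
  simp_rw [conjOp_rankOne]
  rw [opTrace_integral_rankOne_comp p (continuous_opTensor_displacement_tmsv hr)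
    (fun β => norm_opTensor_displacement_apply β _)]
  simp_rw [inner_displaced_eq, inner_tmsv hr]
  rw [integral_mul_const]

end Channel

/-! ### Matching the two schemes -/

section Main

variable {n : ℕ}

theorem IsNonnegQPD.charFn_eq {ρ : Op (ModeSpace n)} {s : ℝ} {W : Measure (Phase n)}
    (hW : IsNonnegQPD ρ s W) (α : Phase n) :
    charFn ρ α = (Real.exp (-(s * normSqSum α / 2)) : ℂ) * ∫ β, sympChar β α ∂W := by
  rw [hW.fourier, orderedCharFn, ← mul_assoc, ← Complex.ofReal_mul, ← Real.exp_add]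
  simp

theorem IsNonnegQPD.charFn_sq_eq {ρ : Op (ModeSpace n)} {s : ℝ} {W : Measure (Phase n)}
    (hW : IsNonnegQPD ρ s W) (α : Phase n) :
    charFn ρ α ^ 2 = (Real.exp (-(s * normSqSum α)) : ℂ) * ∫ β, sympChar β α ∂(W.conv W) := by
  have := hW.isProbability
  rw [hW.charFn_eq, integral_sympChar_conv, mul_pow, ← Complex.ofReal_pow, ← Real.exp_nat_mul, sq]
  congr 4
  push_cast
  ring

/-- The noise `e^{-2r}` of finite squeezing and the added Gaussian noise `s - e^{-2r}` total `s`, so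
`r` drops out. -/
theorem bellSlice_channelLearningState_conv {ρ : Op (ModeSpace n)} {s r : ℝ}
    {W : Measure (Phase n)} (hW : IsNonnegQPD ρ s W) (hr : 0 ≤ r)
    (hsr : 0 ≤ s - Real.exp (-2 * r)) (α : Phase n) :
    bellSlice (channelLearningState
      ((W.conv W).conv (complexGaussian n (s - Real.exp (-2 * r)).toNNReal)) r) α =
      (Real.exp (-(s * normSqSum α)) : ℂ) * ∫ β, sympChar β α ∂(W.conv W) := by
  have := hW.isProbability
  rw [bellSlice_channelLearningState _ hr, integral_sympChar_conv,
    integral_sympChar_complexGaussian, Real.coe_toNNReal _ hsr, mul_assoc, ← Complex.ofReal_mul,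
    ← Real.exp_add, mul_comm]
  congr 3
  ring

theorem exp_neg_two_mul_le {s r : ℝ} (hs : 0 < s) (hr : (1 / 2) * Real.log (1 / s) ≤ r) :
    Real.exp (-2 * r) ≤ s := by
  rw [one_div s, Real.log_inv] at hr
  rw [← Real.le_log_iff_exp_le hs]
  linarith

end Main

end BosonicLearning

end

open BosonicLearning in
theorem mainTheorem9 (n : ℕ) (ρ : Op (ModeSpace n)) (hρ : IsState ρ)
    (hs : 0 < classicality ρ) :
    ∃ W : Measure (Phase n), IsNonnegQPD ρ (classicality ρ) W ∧
      ∀ r : ℝ, (1 / 2) * Real.log (1 / classicality ρ) ≤ r →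
        0 ≤ classicality ρ - Real.exp (-2 * r) ∧
        ∃ p : Measure (Phase n),
          p = (W.conv W).conv
            (complexGaussian n (classicality ρ - Real.exp (-2 * r)).toNNReal) ∧
          IsProbabilityMeasure p ∧
          ∀ U : Matrix (Fin n) (Fin n) ℂ, U ∈ Matrix.unitaryGroup (Fin n) ℂ → U.transpose = U →
            ∀ σ V : Op (ModeSpace n), IsReflectedState U ρ σ → IsPassiveUnitary U V →
              ∃ f : Phase n → ℝ,
                IsBellDensity (stateLearningState ρ σ V) f ∧
                IsBellDensity (channelLearningState p r) f := by
  obtain ⟨W, hW⟩ := exists_isNonnegQPD_classicality hs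
  have := hW.isProbability
  refine ⟨W, hW, fun r hr => ?_⟩
  have hsr := sub_nonneg.2 (exp_neg_two_mul_le hs hr)
  -- The threshold is nonnegative because `s_max ≤ 1`; the squeezed-vacuum series was evaluated for
  -- `r ≥ 0`.
  have hr0 : 0 ≤ r := by
    have h1 : 1 ≤ 1 / classicality ρ := (one_le_div hs).2 classicality_le_one
    have h2 := Real.log_nonneg h1
    linarith
  -- The common density is the reflection of `(W * W) * 𝒩_{s_max}`, the same for all `r`, `U`, `σ`
  -- and `V`.
  refine ⟨hsr, _, rfl, inferInstance, fun U hU _ σ V hσ hV =>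
    ⟨smoothedDensity (classicality ρ) (W.conv W), ?_, ?_⟩⟩
  · exact isBellDensity_smoothedDensity hs fun α => by
      rw [bellSlice_stateLearningState_eq_sq hU hρ hσ hV, hW.charFn_sq_eq]
  · exact isBellDensity_smoothedDensity hs fun α =>
      bellSlice_channelLearningState_conv hW hr0 hsr α
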